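/- For an integer $n\ge 1$ and $\beta\ge 0$, the Curie–Weiss model (Ising model on the complete graph $K_n$) is the probability measure on $\Omega_n=\{-1,1\}^n$ given by $$\mu_n(\sigma)=\frac{1}{Z_n(\beta)}\exp\Big(\frac{\beta}{n}\sum_{1\le i<j\le n}\sigma(i)\sigma(j)\Big),$$ where $Z_n(\beta)$ is the normalizing constant. The Glauber dynamics $(X^n_t)_{t=0,1,2,\dots}$ is the Markov chain on $\Omega_n$ which, at each step, from the state $\sigma$, selects a vertex $i\in\{1,\dots,n\}$ uniformly at random and replaces the spin at $i$ by $+1$ with probability $e^{\beta m_i}/(e^{\beta m_i}+e^{-\beta m_i})$ and by $-1$ otherwise, where $m_i=\frac1n\sum_{j\ne i}\sigma(j)$, leaving all other spins unchanged. Let $$d_n(t)=\max_{\sigma\in\Omega_n}\big\|\mathbf P_\sigma(X^n_t\in\cdot)-\mu_n\big\|_{\rm TV},\qquad \|\mu-\nu\|_{\rm TV}=\max_{A\subseteq\Omega_n}|\mu(A)-\nu(A)|.$$ For real $s \ge 0$ write $d_n(s)=d_n(\lfloor s\rfloor)$, and for $s<0$ write $d_n(s)=d_n(0)$. **Theorem.**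 Let $0\le\beta<1$. Then the Glauber dynamics for the Ising model on $K_n$ has a cut-off at $t_n=[2(1-\beta)]^{-1}n\log n$ with window $n$; that is, $n=o(t_n)$ as $n\to\infty$, and $$\lim_{\gamma\to\infty}\liminf_{n\to\infty}d_n(t_n-\gamma n)=1,\qquad \lim_{\gamma\to\infty}\limsup_{n\to\infty}d_n(t_n+\gamma n)=0 .$$ -/

import Mathlib

open Filter Topology Asymptotics

noncomputable section

namespace CurieWeiss

/-- Configurations of spins `±1` on the vertices of `K_n`; the two-element type `{-1, 1}` is
the group of units of `ℤ`. -/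
abbrev Config (n : ℕ) : Type := Fin n → ℤˣ

/-- The spin at a vertex, as a real number. -/
def spin {n : ℕ} (σ : Config n) (i : Fin n) : ℝ := ((σ i : ℤ) : ℝ)

/-- The unnormalized weight `exp ((β / n) * ∑_{i < j} σ(i) σ(j))`. -/
def weight (β : ℝ) (n : ℕ) (σ : Config n) : ℝ :=
  Real.exp (β / n * ∑ i : Fin n, ∑ j ∈ Finset.Ioi i, spin σ i * spin σ j)

/-- The Ising (Gibbs) measure on `K_n`, as a mass function. -/
def gibbs (β : ℝ) (n : ℕ) (σ : Config n) : ℝ :=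
  weight β n σ / ∑ η : Config n, weight β n η

/-- The local field `(1 / n) * ∑_{j ≠ i} σ(j)` at the vertex `i`. -/
def localField {n : ℕ} (σ : Config n) (i : Fin n) : ℝ :=
  (1 / n : ℝ) * ∑ j ∈ Finset.univ.erase i, spin σ j

/-- The probability that the updated spin at `i` is `s`, given that the current configuration is
`σ` and that the vertex `i` is selected. -/
def updateProb (β : ℝ) {n : ℕ} (σ : Config n) (i : Fin n) (s : ℤˣ) : ℝ :=
  Real.exp (β * ((s : ℤ) : ℝ) * localField σ i) /
    (Real.exp (β * localField σ i) + Real.exp (-(β * localField σ i)))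

/-- The transition matrix of the single-site Glauber dynamics: a uniformly chosen vertex `i` is
selected and its spin is replaced by `s` with probability `updateProb β σ i s`. -/
def glauber (β : ℝ) (n : ℕ) : Matrix (Config n) (Config n) ℝ := fun σ η =>
  ∑ i : Fin n, (1 / n : ℝ) *
    ∑ s : ℤˣ, if η = Function.update σ i s then updateProb β σ i s else 0

/-- The law of the Glauber dynamics after `t` steps, started at `σ`, as a mass function. -/
def law (β : ℝ) (n t : ℕ) (σ : Config n) : Config n → ℝ := (glauber β n ^ t) σ

/-- Total variation distance `max_A |μ(A) - ν(A)|` of two probability mass functions on a finite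
type. -/
def tvDist {Ω : Type*} [Fintype Ω] (μ ν : Ω → ℝ) : ℝ :=
  (Finset.univ : Finset (Finset Ω)).sup' Finset.univ_nonempty
    fun A => |∑ x ∈ A, μ x - ∑ x ∈ A, ν x|

/-- The worst-case distance to stationarity of the Glauber dynamics after `t` steps. -/
def dist (β : ℝ) (n t : ℕ) : ℝ :=
  (Finset.univ : Finset (Config n)).sup' Finset.univ_nonempty
    fun σ => tvDist (law β n t σ) (gibbs β n)

/-- The distances `d n` to stationarity have a cut-off at `t` with window `w`. Times are rounded
down to natural numbers (a negative time becomes `0`; when `w = o(t)` and `t` is eventually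
positive, this happens for only finitely many `n` for each `γ`). -/
def HasCutoff (d : ℕ → ℕ → ℝ) (t w : ℕ → ℝ) : Prop :=
  w =o[atTop] t ∧
  Tendsto (fun γ : ℝ => liminf (fun n : ℕ => d n ⌊t n - γ * w n⌋₊) atTop) atTop (𝓝 1) ∧
  Tendsto (fun γ : ℝ => limsup (fun n : ℕ => d n ⌊t n + γ * w n⌋₊) atTop) atTop (𝓝 0)

end CurieWeiss

end

/-!
Write `P` for the Markov operator of the dynamics (`step`), `∇ᵢ h` for the discrete derivative of an
observable `h` at the vertex `i` (`grad`), and `r = 1 - (1 - β) / n`. Everything rests on an exact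
formula for `∇ᵢ (P h)` (`grad_step`): a step transports `∇ᵢ h`, except when `i` itself is updated,
and adds terms `∇ⱼ h` with coefficients of size at most `β / n²`.

*Upper bound.* The formula shows that the sum over `i` of the sup-norms of the derivatives contracts
by the factor `r` in each step (`exists_grad_step_pow_le`). After the time
`n log n / (2 (1 - β)) + γ n` this factor is `n ^ (-1/2) * exp (-(1 - β) γ)`, so it suffices to
produce, at the cost of `n - 1` further steps, a gradient whose coordinates sum to `O(√n)`. Two facts
do this. First, the formula also gives the commutation estimate
`|∇ P h|² ≤ (1 + O(1 / n)) P |∇ h|²` (`gradSq_step_le`), and summing the variances created in the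
successive steps turns it into a reverse Poincaré inequality: `|∇ P^(n-1) f|² ≤ C` at every
configuration whenever `|f| ≤ 1` (`gradSq_step_pow_le_const`). Second, the law started at `σ₀` and the
Gibbs measure are both invariant under the permutations of the vertices that fix `σ₀`, so the test
function can be taken invariant as well. Its derivative at `i` is then shared by at least half of the
vertices `j` with `σ₀ j = σ₀ i`, at `σ` or at `σ` with the spin at `i` reversed, and the Euclidean
bound becomes a bound of order `k ^ (-1/2)` on each derivative, `k` being the size of that class
(`card_mul_grad_sq_le`). With only two classes the sum over all vertices is `O(√n)` (`dist_le`).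

*Lower bound.* Start from a configuration whose magnetization is a small multiple of `n`. The drift of
the magnetization is linear up to a quadratic error that is controlled by the second moment, so its
mean at time `n log n / (2 (1 - β)) - γ n` is at least of order `√n * exp ((1 - β) γ)`
(`step_pow_mag_ge`). Its variance stays `O(n)` by the contraction of the gradient
(`variance_step_pow_le`), its second moment in equilibrium is `O(n)` by stationarity
(`sum_gibbs_mul_mag_sq_le`), and Chebyshev's inequality separates the two laws (`le_dist`).
-/

namespace CurieWeiss

/-! ### Spins and magnetization -/

theorem sum_units (f : ℤˣ → ℝ) : ∑ s, f s = f 1 + f (-1) := by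
  rw [show (Finset.univ : Finset ℤˣ) = {1, -1} by decide, Finset.sum_pair (by decide)]

/-- The total magnetization `∑ i, σ(i)`. -/
noncomputable def mag {n : ℕ} (σ : Config n) : ℝ := ∑ i, spin σ i

theorem spin_eq_or {n : ℕ} (σ : Config n) (i : Fin n) : spin σ i = 1 ∨ spin σ i = -1 := by
  rcases Int.units_eq_one_or (σ i) with h | h <;> simp [spin, h]

theorem spin_sq {n : ℕ} (σ : Config n) (i : Fin n) : spin σ i ^ 2 = 1 := by
  rcases spin_eq_or σ i with h | h <;> simp [h]

theorem abs_spin {n : ℕ} (σ : Config n) (i : Fin n) : |spin σ i| = 1 := by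
  rcases spin_eq_or σ i with h | h <;> simp [h]

theorem spin_update_self {n : ℕ} (σ : Config n) (i : Fin n) (s : ℤˣ) :
    spin (Function.update σ i s) i = ((s : ℤ) : ℝ) := by
  simp [spin]

theorem spin_update_of_ne {n : ℕ} (σ : Config n) {i j : Fin n} (h : j ≠ i) (s : ℤˣ) :
    spin (Function.update σ i s) j = spin σ j := by
  simp [spin, h]

theorem localField_eq {n : ℕ} (σ : Config n) (i : Fin n) :
    localField σ i = (mag σ - spin σ i) / n := by
  rw [localField, mag, ← Finset.add_sum_erase _ _ (Finset.mem_univ i)]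
  ring

theorem localField_update_self {n : ℕ} (σ : Config n) (i : Fin n) (s : ℤˣ) :
    localField (Function.update σ i s) i = localField σ i := by
  unfold localField
  congr 1
  exact Finset.sum_congr rfl fun j hj => spin_update_of_ne σ (Finset.ne_of_mem_erase hj) s

theorem mag_update {n : ℕ} (σ : Config n) (i : Fin n) (s : ℤˣ) :
    mag (Function.update σ i s) = mag σ - spin σ i + ((s : ℤ) : ℝ) := by
  rw [mag, mag, ← Finset.add_sum_erase _ _ (Finset.mem_univ i),
    ← Finset.add_sum_erase _ (spin σ) (Finset.mem_univ i), spin_update_self,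
    Finset.sum_congr rfl fun j hj => spin_update_of_ne σ (Finset.ne_of_mem_erase hj) s]
  ring

theorem abs_mag_le {n : ℕ} (σ : Config n) : |mag σ| ≤ n := by
  refine (Finset.abs_sum_le_sum_abs _ _).trans ?_
  simp [abs_spin]

theorem abs_localField_le {n : ℕ} (σ : Config n) (i : Fin n) : |localField σ i| ≤ 1 := by
  have hn : 0 < n := i.pos
  have hn' : (0 : ℝ) < n := by exact_mod_cast hn
  have h : |∑ j ∈ Finset.univ.erase i, spin σ j| ≤ n := by
    refine (Finset.abs_sum_le_sum_abs _ _).trans ?_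
    simp [abs_spin]
  rw [localField, abs_mul, abs_of_nonneg (by positivity : (0 : ℝ) ≤ 1 / n), one_div,
    inv_mul_le_iff₀ hn']
  linarith

/-! ### Update probabilities -/

theorem updateProb_pos (β : ℝ) {n : ℕ} (σ : Config n) (i : Fin n) (s : ℤˣ) :
    0 < updateProb β σ i s := by
  unfold updateProb; positivity

theorem updateProb_add (β : ℝ) {n : ℕ} (σ : Config n) (i : Fin n) :
    updateProb β σ i 1 + updateProb β σ i (-1) = 1 := by
  simp only [updateProb]
  rw [← add_div, div_eq_one_iff_eq (by positivity)]
  simp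

theorem updateProb_sub (β : ℝ) {n : ℕ} (σ : Config n) (i : Fin n) :
    updateProb β σ i 1 - updateProb β σ i (-1) = Real.tanh (β * localField σ i) := by
  simp only [updateProb, Real.tanh_eq]
  rw [← sub_div]
  simp

theorem updateProb_one (β : ℝ) {n : ℕ} (σ : Config n) (i : Fin n) :
    updateProb β σ i 1 = (1 + Real.tanh (β * localField σ i)) / 2 := by
  linarith [updateProb_add β σ i, updateProb_sub β σ i]

theorem updateProb_update_self (β : ℝ) {n : ℕ} (σ : Config n) (i : Fin n) (s a : ℤˣ) :
    updateProb β (Function.update σ i a) i s = updateProb β σ i s := by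
  simp only [updateProb, localField_update_self]

/-- Every update has probability at least `e⁻² / 2` when `0 ≤ β ≤ 1`. -/
theorem le_updateProb {β : ℝ} (hβ0 : 0 ≤ β) (hβ1 : β ≤ 1) {n : ℕ} (σ : Config n) (i : Fin n)
    (s : ℤˣ) : Real.exp (-2) / 2 ≤ updateProb β σ i s := by
  have hx : |β * localField σ i| ≤ 1 := by
    rw [abs_mul, abs_of_nonneg hβ0]
    exact mul_le_one₀ hβ1 (abs_nonneg _) (abs_localField_le σ i)
  obtain ⟨h1, h2⟩ := abs_le.1 hx
  unfold updateProb
  rw [div_le_div_iff₀ (by norm_num) (by positivity)]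
  have e1 : Real.exp (β * localField σ i) ≤ Real.exp 1 := Real.exp_le_exp.2 h2
  have e2 : Real.exp (-(β * localField σ i)) ≤ Real.exp 1 := Real.exp_le_exp.2 (by linarith)
  have e3 : Real.exp (-1) ≤ Real.exp (β * ((s : ℤ) : ℝ) * localField σ i) := by
    apply Real.exp_le_exp.2
    rcases Int.units_eq_one_or s with h | h <;> simp [h] <;> linarith
  have e4 : Real.exp (-2) * Real.exp 1 = Real.exp (-1) := by
    rw [← Real.exp_add]; norm_num
  nlinarith [Real.exp_pos (-2)]

theorem hasDerivAt_tanh (x : ℝ) : HasDerivAt Real.tanh (1 - Real.tanh x ^ 2) x := by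
  have h := (Real.hasDerivAt_sinh x).div (Real.hasDerivAt_cosh x) (Real.cosh_pos x).ne'
  have e : Real.tanh = Real.sinh / Real.cosh := by
    funext y; rw [Pi.div_apply, Real.tanh_eq_sinh_div_cosh]
  rw [e]
  refine h.congr_deriv ?_
  have := (Real.cosh_pos x).ne'
  rw [Pi.div_apply]
  field_simp

theorem tanh_sq_le_one (x : ℝ) : Real.tanh x ^ 2 ≤ 1 := by
  rw [Real.tanh_eq_sinh_div_cosh, div_pow, div_le_one (by have := Real.cosh_pos x; positivity)]
  nlinarith [Real.cosh_sq x]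

theorem abs_tanh_sub_le (x y : ℝ) : |Real.tanh x - Real.tanh y| ≤ |x - y| := by
  have h := convex_univ.norm_image_sub_le_of_norm_hasDerivWithin_le (𝕜 := ℝ) (C := 1)
    (f := Real.tanh) (fun x _ => (hasDerivAt_tanh x).hasDerivWithinAt) (fun x _ => by
      rw [Real.norm_eq_abs, abs_le]
      constructor <;> nlinarith [tanh_sq_le_one x, sq_nonneg (Real.tanh x)])
    (Set.mem_univ y) (Set.mem_univ x)
  simpa using h

theorem abs_tanh_le (x : ℝ) : |Real.tanh x| ≤ |x| := by
  simpa using abs_tanh_sub_le x 0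

theorem abs_tanh_sub_self_le (x : ℝ) : |Real.tanh x - x| ≤ x ^ 2 := by
  -- the derivative of `tanh - id` is `-tanh²`, of size at most `|x|` on `[-|x|, |x|]`
  have h := (convex_Icc (-|x|) |x|).norm_image_sub_le_of_norm_hasDerivWithin_le (𝕜 := ℝ)
    (C := |x|) (f := fun y => Real.tanh y - y)
    (fun y _ => ((hasDerivAt_tanh y).sub (hasDerivAt_id y)).hasDerivWithinAt) (fun y hy => by
      have h1 := abs_tanh_le y
      have h2 := abs_le.2 hy
      have h3 := tanh_sq_le_one y
      have h4 : |Real.tanh y| ≤ 1 := by rwa [← sq_le_one_iff_abs_le_one]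
      have : ‖1 - Real.tanh y ^ 2 - 1‖ = |Real.tanh y| * |Real.tanh y| := by
        rw [Real.norm_eq_abs, ← abs_mul, ← sq, sub_sub_cancel_left, abs_neg]
      rw [this]
      nlinarith [abs_nonneg (Real.tanh y)])
    (show (0 : ℝ) ∈ Set.Icc (-|x|) |x| by simp)
    (show x ∈ Set.Icc (-|x|) |x| from ⟨neg_abs_le x, le_abs_self x⟩)
  simpa [sq] using h

/-- The influence of the spin at `i` on the update probability at `j`. -/
noncomputable def influence (β : ℝ) {n : ℕ} (σ : Config n) (i j : Fin n) : ℝ :=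
  updateProb β (Function.update σ i 1) j 1 - updateProb β (Function.update σ i (-1)) j 1

theorem abs_influence_le {β : ℝ} (hβ0 : 0 ≤ β) {n : ℕ} (σ : Config n) {i j : Fin n} (h : j ≠ i) :
    |influence β σ i j| ≤ β / n := by
  have hn : (0 : ℝ) < n := by exact_mod_cast i.pos
  have h1 := abs_tanh_sub_le (β * localField (Function.update σ i 1) j)
    (β * localField (Function.update σ i (-1)) j)
  have h2 : β * localField (Function.update σ i 1) j -
      β * localField (Function.update σ i (-1)) j = 2 * (β / n) := by
    rw [localField_eq, localField_eq, mag_update, mag_update, spin_update_of_ne σ h,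
      spin_update_of_ne σ h]
    simp
    ring
  rw [h2, abs_of_nonneg (by positivity : 0 ≤ 2 * (β / n))] at h1
  rw [influence, updateProb_one, updateProb_one, ← sub_div, add_sub_add_left_eq_sub, abs_div,
    abs_two]
  linarith

/-! ### The averaging operator of the dynamics -/

/-- The Markov operator of the Glauber dynamics, acting on observables. -/
noncomputable def step (β : ℝ) (n : ℕ) : Module.End ℝ (Config n → ℝ) :=
  Matrix.toLinAlgEquiv' (glauber β n)

theorem step_apply (β : ℝ) {n : ℕ} (h : Config n → ℝ) (σ : Config n) :
    step β n h σ =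
      (1 / n : ℝ) * ∑ i, ∑ s, updateProb β σ i s * h (Function.update σ i s) := by
  simp only [step, Matrix.toLinAlgEquiv'_apply, Matrix.mulVec, dotProduct, glauber, Finset.sum_mul]
  rw [Finset.sum_comm, Finset.mul_sum]
  refine Finset.sum_congr rfl fun i _ => ?_
  simp only [mul_assoc, ← Finset.mul_sum]
  congr 1
  simp only [Finset.sum_mul]
  rw [Finset.sum_comm]
  refine Finset.sum_congr rfl fun s _ => ?_
  simp [ite_mul]

theorem step_pow_apply (β : ℝ) {n : ℕ} (t : ℕ) (h : Config n → ℝ) (σ : Config n) :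
    (step β n ^ t) h σ = ∑ η, law β n t σ η * h η := by
  rw [step, ← map_pow]
  rfl

theorem step_pow_succ (β : ℝ) {n : ℕ} (t : ℕ) (h : Config n → ℝ) :
    (step β n ^ (t + 1)) h = (step β n ^ t) (step β n h) := by
  rw [pow_succ, Module.End.mul_apply]

theorem step_pow_succ' (β : ℝ) {n : ℕ} (t : ℕ) (h : Config n → ℝ) :
    (step β n ^ (t + 1)) h = step β n ((step β n ^ t) h) := by
  rw [pow_succ', Module.End.mul_apply]

theorem step_mono (β : ℝ) {n : ℕ} {f g : Config n → ℝ} (h : ∀ σ, f σ ≤ g σ) (σ : Config n) :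
    step β n f σ ≤ step β n g σ := by
  rw [step_apply, step_apply]
  gcongr with i _ s _
  · exact (updateProb_pos β σ i s).le
  · exact h _

theorem step_pow_mono (β : ℝ) {n : ℕ} (t : ℕ) {f g : Config n → ℝ} (h : ∀ σ, f σ ≤ g σ)
    (σ : Config n) : (step β n ^ t) f σ ≤ (step β n ^ t) g σ := by
  induction t generalizing σ with
  | zero => exact h σ
  | succ t ih =>
    rw [step_pow_succ', step_pow_succ']
    exact step_mono β ih σ

theorem step_const (β : ℝ) {n : ℕ} [NeZero n] (c : ℝ) :
    step β n (fun _ => c) = fun _ => c := by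
  funext σ
  have hn : (n : ℝ) ≠ 0 := NeZero.ne _
  rw [step_apply]
  simp only [sum_units, ← add_mul, updateProb_add]
  simp [hn]

theorem step_pow_const (β : ℝ) {n : ℕ} [NeZero n] (t : ℕ) (c : ℝ) :
    (step β n ^ t) (fun _ => c) = fun _ => c := by
  induction t with
  | zero => rfl
  | succ t ih => rw [step_pow_succ', ih, step_const]

/-! ### Discrete gradients -/

/-- The discrete derivative of an observable in the direction of the spin at `i`. -/
def grad {n : ℕ} (i : Fin n) (h : Config n → ℝ) (σ : Config n) : ℝ :=
  h (Function.update σ i 1) - h (Function.update σ i (-1))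

/-- The configuration `σ` with the spin at `i` reversed. -/
def flip {n : ℕ} (i : Fin n) (σ : Config n) : Config n := Function.update σ i (-σ i)

theorem grad_update_self {n : ℕ} (i : Fin n) (h : Config n → ℝ) (σ : Config n) (s : ℤˣ) :
    grad i h (Function.update σ i s) = grad i h σ := by
  simp [grad]

theorem abs_update_sub_le {n : ℕ} (i : Fin n) (h : Config n → ℝ) (σ : Config n) (s : ℤˣ) :
    |h (Function.update σ i s) - h σ| ≤ |grad i h σ| := by
  have e : Function.update σ i (σ i) = σ := Function.update_eq_self i σ
  rcases Int.units_eq_one_or (σ i) with h1 | h1 <;> rw [h1] at e <;>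
    rcases Int.units_eq_one_or s with h2 | h2 <;> rw [h2] <;> simp [grad, e, abs_sub_comm]

theorem sq_flip_sub {n : ℕ} (i : Fin n) (h : Config n → ℝ) (σ : Config n) :
    (h (flip i σ) - h σ) ^ 2 = grad i h σ ^ 2 := by
  have e : Function.update σ i (σ i) = σ := Function.update_eq_self i σ
  rcases Int.units_eq_one_or (σ i) with h1 | h1 <;> rw [h1] at e
  all_goals
    simp [grad, e, flip, h1]
    try ring

/-- One step of the dynamics transports the derivative at `i`, kills it when `i` is updated, and
creates derivatives at the other vertices through the influence of the spin at `i`. -/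
theorem grad_step (β : ℝ) {n : ℕ} (i : Fin n) (h : Config n → ℝ) (σ : Config n) :
    grad i (step β n h) σ =
      (1 / n : ℝ) * ∑ j ∈ Finset.univ.erase i,
          ∑ s, updateProb β σ j s * grad i h (Function.update σ j s) +
      (1 / n : ℝ) * ∑ j ∈ Finset.univ.erase i, influence β σ i j * grad j h (flip i σ) := by
  rw [grad, step_apply, step_apply, ← mul_sub, ← mul_add, ← Finset.sum_sub_distrib,
    ← Finset.add_sum_erase _ _ (Finset.mem_univ i), ← Finset.sum_add_distrib]
  simp only [updateProb_update_self, Function.update_idem, sub_self, zero_add]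
  congr 1
  refine Finset.sum_congr rfl fun j hj => ?_
  have hji : j ≠ i := Finset.ne_of_mem_erase hj
  have e : Function.update σ i (σ i) = σ := Function.update_eq_self i σ
  have a1 := updateProb_add β (Function.update σ i 1) j
  have a2 := updateProb_add β (Function.update σ i (-1)) j
  have c (a b : ℤˣ) : Function.update (Function.update σ j b) i a =
      Function.update (Function.update σ i a) j b := Function.update_comm hji b a σ
  rw [← eq_sub_iff_add_eq'] at a1 a2
  rcases Int.units_eq_one_or (σ i) with h1 | h1 <;> rw [h1] at e
  all_goals
    simp only [sum_units, grad, flip, influence, h1, neg_neg, c, a1, a2, e] at *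
    simp only [a1, a2]
    ring

/-! ### Contraction of the supremum of the gradient -/

theorem abs_sum_updateProb_mul_le (β : ℝ) {n : ℕ} (σ : Config n) (j : Fin n) {f : ℤˣ → ℝ} {c : ℝ}
    (h : ∀ s, |f s| ≤ c) : |∑ s, updateProb β σ j s * f s| ≤ c := by
  calc |∑ s, updateProb β σ j s * f s| ≤ ∑ s, |updateProb β σ j s * f s| :=
        Finset.abs_sum_le_sum_abs _ _
    _ ≤ ∑ s, updateProb β σ j s * c := by
        gcongr with s _
        rw [abs_mul, abs_of_pos (updateProb_pos β σ j s)]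
        gcongr
        · exact (updateProb_pos β σ j s).le
        · exact h s
    _ = c := by rw [sum_units, ← add_mul, updateProb_add, one_mul]

theorem abs_grad_step_le {β : ℝ} (hβ0 : 0 ≤ β) {n : ℕ} {h : Config n → ℝ} {L : Fin n → ℝ}
    (hL : ∀ i σ, |grad i h σ| ≤ L i) (i : Fin n) (σ : Config n) :
    |grad i (step β n h) σ| ≤ (1 - 1 / n) * L i + β / n * (1 / n * ∑ j, L j) := by
  have hn : (0 : ℝ) < n := by exact_mod_cast i.pos
  have hn1 : 1 ≤ n := i.pos
  have hL0 (j : Fin n) : 0 ≤ L j := (abs_nonneg _).trans (hL j σ)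
  rw [grad_step]
  refine (abs_add_le _ _).trans (add_le_add ?_ ?_)
  · rw [abs_mul, abs_of_nonneg (by positivity : (0 : ℝ) ≤ 1 / n)]
    calc (1 / n : ℝ) * |∑ j ∈ Finset.univ.erase i,
            ∑ s, updateProb β σ j s * grad i h (Function.update σ j s)|
        ≤ (1 / n : ℝ) * ∑ j ∈ Finset.univ.erase i, L i := by
          gcongr
          refine (Finset.abs_sum_le_sum_abs _ _).trans (Finset.sum_le_sum fun j _ => ?_)
          exact abs_sum_updateProb_mul_le β σ j fun s => hL i _
      _ = (1 - 1 / n) * L i := by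
          simp only [Finset.sum_const, Finset.card_erase_of_mem (Finset.mem_univ i),
            Finset.card_univ, Fintype.card_fin, nsmul_eq_mul]
          push_cast [hn1]
          field_simp
  · rw [abs_mul, abs_of_nonneg (by positivity : (0 : ℝ) ≤ 1 / n)]
    calc (1 / n : ℝ) * |∑ j ∈ Finset.univ.erase i, influence β σ i j * grad j h (flip i σ)|
        ≤ (1 / n : ℝ) * ∑ j ∈ Finset.univ.erase i, β / n * L j := by
          gcongr
          refine (Finset.abs_sum_le_sum_abs _ _).trans (Finset.sum_le_sum fun j hj => ?_)
          rw [abs_mul]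
          exact mul_le_mul (abs_influence_le hβ0 σ (Finset.ne_of_mem_erase hj)) (hL j _)
            (abs_nonneg _) (by positivity)
      _ ≤ (1 / n : ℝ) * ∑ j, β / n * L j := by
          refine mul_le_mul_of_nonneg_left ?_ (by positivity)
          exact Finset.sum_le_sum_of_subset_of_nonneg (Finset.erase_subset _ _)
            fun j _ _ => mul_nonneg (by positivity) (hL0 j)
      _ = β / n * (1 / n * ∑ j, L j) := by rw [← Finset.mul_sum]; ring

theorem rate_nonneg {β : ℝ} (hβ0 : 0 ≤ β) (n : ℕ) : 0 ≤ 1 - (1 - β) / n := by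
  rcases Nat.eq_zero_or_pos n with rfl | h
  · simp
  · have : (1 : ℝ) ≤ n := by exact_mod_cast h
    have : (1 - β) / n ≤ 1 := by rw [div_le_one (by positivity)]; linarith
    linarith

/-- The influence matrix is symmetric with row sums at most `β / n`, so the total of the
sup-norms of the partial derivatives decays like `(1 - (1 - β) / n) ^ t`. -/
theorem exists_grad_step_pow_le {β : ℝ} (hβ0 : 0 ≤ β) {n : ℕ} [NeZero n] {h : Config n → ℝ}
    {L : Fin n → ℝ} (hL : ∀ i σ, |grad i h σ| ≤ L i) (t : ℕ) :
    ∃ L' : Fin n → ℝ, (∀ i σ, |grad i ((step β n ^ t) h) σ| ≤ L' i) ∧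
      ∑ i, L' i = (1 - (1 - β) / n) ^ t * ∑ i, L i := by
  have hn : (n : ℝ) ≠ 0 := NeZero.ne _
  induction t with
  | zero => exact ⟨L, hL, by simp⟩
  | succ t ih =>
    obtain ⟨L', h1, h2⟩ := ih
    refine ⟨fun i => (1 - 1 / n) * L' i + β / n * (1 / n * ∑ j, L' j), fun i σ => ?_, ?_⟩
    · rw [step_pow_succ']
      exact abs_grad_step_le hβ0 h1 i σ
    · rw [Finset.sum_add_distrib, ← Finset.mul_sum, Finset.sum_const, h2, Finset.card_univ,
        Fintype.card_fin, nsmul_eq_mul, pow_succ]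
      generalize (1 - (1 - β) / n) ^ t = r
      field_simp
      ring

theorem abs_grad_step_pow_le {β : ℝ} (hβ0 : 0 ≤ β) {n : ℕ} [NeZero n] {h : Config n → ℝ}
    {c : ℝ} (hc : ∀ i σ, |grad i h σ| ≤ c) (t : ℕ) (i : Fin n) (σ : Config n) :
    |grad i ((step β n ^ t) h) σ| ≤ (1 - (1 - β) / n) ^ t * c := by
  have hn : (n : ℝ) ≠ 0 := NeZero.ne _
  induction t generalizing i σ with
  | zero => simpa using hc i σ
  | succ t ih =>
    rw [step_pow_succ']
    refine (abs_grad_step_le hβ0 ih i σ).trans (le_of_eq ?_)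
    rw [Finset.sum_const, Finset.card_univ, Fintype.card_fin, nsmul_eq_mul, pow_succ]
    generalize (1 - (1 - β) / n) ^ t = r
    field_simp
    ring

theorem abs_sub_le_sum_grad {n : ℕ} {h : Config n → ℝ} {L : Fin n → ℝ}
    (hL : ∀ i σ, |grad i h σ| ≤ L i) (σ η : Config n) : |h η - h σ| ≤ ∑ i, L i := by
  have key (s : Finset (Fin n)) : |h (s.piecewise η σ) - h σ| ≤ ∑ i ∈ s, L i := by
    induction s using Finset.induction_on with
    | empty => simp
    | insert i s hi ih =>
      rw [Finset.piecewise_insert, Finset.sum_insert hi]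
      have h1 := (abs_update_sub_le i h (s.piecewise η σ) (η i)).trans (hL i _)
      calc _ = |(h (Function.update (s.piecewise η σ) i (η i)) - h (s.piecewise η σ)) +
            (h (s.piecewise η σ) - h σ)| := by ring_nf
        _ ≤ _ := (abs_add_le _ _).trans (add_le_add h1 ih)
  simpa using key Finset.univ

/-! ### The reverse Poincaré inequality -/

/-- The squared length of the discrete gradient. -/
def gradSq {n : ℕ} (h : Config n → ℝ) (σ : Config n) : ℝ := ∑ i, grad i h σ ^ 2

theorem gradSq_nonneg {n : ℕ} (h : Config n → ℝ) (σ : Config n) : 0 ≤ gradSq h σ :=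
  Finset.sum_nonneg fun _ _ => sq_nonneg _

theorem sq_sum_updateProb_mul_le (β : ℝ) {n : ℕ} (σ : Config n) (j : Fin n) (f : ℤˣ → ℝ) :
    (∑ s, updateProb β σ j s * f s) ^ 2 ≤ ∑ s, updateProb β σ j s * f s ^ 2 := by
  have h1 := updateProb_add β σ j
  have h2 := updateProb_pos β σ j 1
  have h3 := updateProb_pos β σ j (-1)
  rw [sum_units, sum_units]
  rw [← eq_sub_iff_add_eq'] at h1
  rw [h1] at h3 ⊢
  nlinarith [mul_nonneg (mul_pos h2 h3).le (sq_nonneg (f 1 - f (-1)))]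

theorem sum_flip_le_step {β : ℝ} (hβ0 : 0 ≤ β) (hβ1 : β ≤ 1) {n : ℕ} {h : Config n → ℝ}
    (hh : ∀ σ, 0 ≤ h σ) (σ : Config n) :
    Real.exp (-2) / 2 / n * ∑ i, h (flip i σ) ≤ step β n h σ := by
  rw [step_apply, div_eq_mul_one_div, mul_comm (_ / 2), mul_assoc, Finset.mul_sum]
  gcongr with i _
  calc Real.exp (-2) / 2 * h (flip i σ) ≤ updateProb β σ i (-σ i) * h (flip i σ) := by
        gcongr
        · exact hh _
        · exact le_updateProb hβ0 hβ1 σ i _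
    _ ≤ _ := Finset.single_le_sum (f := fun s => updateProb β σ i s * h (Function.update σ i s))
        (fun s _ => mul_nonneg (updateProb_pos β σ i s).le (hh _)) (Finset.mem_univ _)

theorem le_step_of_nonneg {β : ℝ} (hβ0 : 0 ≤ β) (hβ1 : β ≤ 1) {n : ℕ} [NeZero n]
    {h : Config n → ℝ} (hh : ∀ σ, 0 ≤ h σ) (σ : Config n) :
    Real.exp (-2) / 2 * h σ ≤ step β n h σ := by
  have hn : (n : ℝ) ≠ 0 := NeZero.ne _
  rw [step_apply]
  calc Real.exp (-2) / 2 * h σ = 1 / n * ∑ i : Fin n, Real.exp (-2) / 2 * h σ := by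
        rw [Finset.sum_const, Finset.card_univ, Fintype.card_fin, nsmul_eq_mul]
        field_simp
    _ ≤ _ := by
        gcongr with i _
        calc Real.exp (-2) / 2 * h σ
            ≤ updateProb β σ i (σ i) * h (Function.update σ i (σ i)) := by
              rw [Function.update_eq_self]
              gcongr
              · exact hh _
              · exact le_updateProb hβ0 hβ1 σ i _
          _ ≤ _ := Finset.single_le_sum
              (f := fun s => updateProb β σ i s * h (Function.update σ i s))
              (fun s _ => mul_nonneg (updateProb_pos β σ i s).le (hh _)) (Finset.mem_univ _)

theorem sq_mean_erase_le {n : ℕ} (i : Fin n) (f : Fin n → ℝ) :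
    ((1 / n : ℝ) * ∑ j ∈ Finset.univ.erase i, f j) ^ 2 ≤ (1 / n : ℝ) * ∑ j, f j ^ 2 := by
  have hn : (0 : ℝ) < n := by exact_mod_cast i.pos
  have h1 : (∑ j ∈ Finset.univ.erase i, f j) ^ 2 ≤ n * ∑ j, f j ^ 2 := by
    refine sq_sum_le_card_mul_sum_sq.trans ?_
    have hc : ((Finset.univ.erase i).card : ℝ) ≤ n := by
      exact_mod_cast (Finset.card_le_univ _).trans (by simp)
    have hs : ∑ j ∈ Finset.univ.erase i, f j ^ 2 ≤ ∑ j, f j ^ 2 :=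
      Finset.sum_le_sum_of_subset_of_nonneg (Finset.erase_subset _ _) fun _ _ _ => sq_nonneg _
    exact mul_le_mul hc hs (Finset.sum_nonneg fun _ _ => sq_nonneg _) hn.le
  rw [mul_pow]
  calc (1 / n : ℝ) ^ 2 * (∑ j ∈ Finset.univ.erase i, f j) ^ 2
      ≤ (1 / n : ℝ) ^ 2 * (n * ∑ j, f j ^ 2) := by gcongr
    _ = _ := by field_simp

/-- Commutation of the gradient with one step of the dynamics, up to a factor `1 + O(1 / n)`. -/
theorem gradSq_step_le {β : ℝ} (hβ0 : 0 ≤ β) (hβ1 : β ≤ 1) {n : ℕ} [NeZero n]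
    (h : Config n → ℝ) (σ : Config n) :
    gradSq (step β n h) σ ≤ (1 + (1 + 4 * Real.exp 2) / n) * step β n (gradSq h) σ := by
  have hn : (0 : ℝ) < n := by exact_mod_cast NeZero.pos n
  have hn1 : (1 : ℝ) ≤ n := by exact_mod_cast NeZero.pos n
  set P := step β n (gradSq h) σ with hP
  set a : Fin n → ℝ := fun i => (1 / n : ℝ) * ∑ j ∈ Finset.univ.erase i,
    ∑ s, updateProb β σ j s * grad i h (Function.update σ j s) with ha
  set b : Fin n → ℝ := fun i => (1 / n : ℝ) * ∑ j ∈ Finset.univ.erase i,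
    influence β σ i j * grad j h (flip i σ) with hb
  have hA : ∑ i, a i ^ 2 ≤ P := by
    calc ∑ i, a i ^ 2 ≤ ∑ i, (1 / n : ℝ) * ∑ j,
          ∑ s, updateProb β σ j s * grad i h (Function.update σ j s) ^ 2 := by
          gcongr with i _
          refine (sq_mean_erase_le i _).trans ?_
          gcongr with j _
          exact sq_sum_updateProb_mul_le β σ j _
      _ = P := by
          rw [hP, step_apply, ← Finset.mul_sum, Finset.sum_comm]
          congr 1
          refine Finset.sum_congr rfl fun j _ => ?_
          rw [Finset.sum_comm]
          simp only [gradSq, Finset.mul_sum]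
  have hB : ∑ i, b i ^ 2 ≤ 2 * Real.exp 2 / n ^ 2 * P := by
    have h1 (i : Fin n) : b i ^ 2 ≤ 1 / n ^ 3 * gradSq h (flip i σ) := by
      have h2 : |b i| ≤ (1 / n) * ∑ j ∈ Finset.univ.erase i, 1 / n * |grad j h (flip i σ)| := by
        rw [hb, abs_mul, abs_of_nonneg (by positivity : (0 : ℝ) ≤ 1 / n)]
        gcongr
        refine (Finset.abs_sum_le_sum_abs _ _).trans (Finset.sum_le_sum fun j hj => ?_)
        rw [abs_mul]
        gcongr
        exact (abs_influence_le hβ0 σ (Finset.ne_of_mem_erase hj)).trans (by gcongr)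
      calc b i ^ 2 = |b i| ^ 2 := (sq_abs _).symm
        _ ≤ ((1 / n) * ∑ j ∈ Finset.univ.erase i, 1 / n * |grad j h (flip i σ)|) ^ 2 := by gcongr
        _ ≤ (1 / n) * ∑ j, (1 / n * |grad j h (flip i σ)|) ^ 2 := sq_mean_erase_le i _
        _ = _ := by
          simp only [mul_pow, sq_abs, ← Finset.mul_sum, gradSq]
          field_simp
    have h2 := sum_flip_le_step hβ0 hβ1 (gradSq_nonneg h) σ
    calc ∑ i, b i ^ 2 ≤ ∑ i, 1 / n ^ 3 * gradSq h (flip i σ) := Finset.sum_le_sum fun i _ => h1 i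
      _ = 2 * Real.exp 2 / n ^ 2 * (Real.exp (-2) / 2 / n * ∑ i, gradSq h (flip i σ)) := by
          rw [← Finset.mul_sum, Real.exp_neg]
          field_simp
      _ ≤ _ := by gcongr
  have hP0 : 0 ≤ P := le_trans (Finset.sum_nonneg fun _ _ => sq_nonneg _) hA
  calc gradSq (step β n h) σ = ∑ i, (a i + b i) ^ 2 := by
        rw [gradSq]
        exact Finset.sum_congr rfl fun i _ => by rw [grad_step]
    _ ≤ ∑ i, ((1 + 1 / n) * a i ^ 2 + (1 + n) * b i ^ 2) := by
        gcongr with i _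
        -- Young's inequality with weight `1 / n`
        have h3 : (1 + 1 / n) * a i ^ 2 + (1 + n) * b i ^ 2 - (a i + b i) ^ 2 =
            1 / n * (a i - n * b i) ^ 2 := by field_simp; ring
        have h4 : 0 ≤ 1 / n * (a i - n * b i) ^ 2 := by positivity
        linarith
    _ = (1 + 1 / n) * ∑ i, a i ^ 2 + (1 + n) * ∑ i, b i ^ 2 := by
        rw [Finset.sum_add_distrib, Finset.mul_sum, Finset.mul_sum]
    _ ≤ (1 + 1 / n) * P + (n + n) * (2 * Real.exp 2 / n ^ 2 * P) := by gcongr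
    _ = _ := by field_simp; ring

theorem gradSq_step_pow_le {β : ℝ} (hβ0 : 0 ≤ β) (hβ1 : β ≤ 1) {n : ℕ} [NeZero n]
    (h : Config n → ℝ) (t : ℕ) (σ : Config n) :
    gradSq ((step β n ^ t) h) σ ≤
      (1 + (1 + 4 * Real.exp 2) / n) ^ t * (step β n ^ t) (gradSq h) σ := by
  induction t generalizing σ with
  | zero => simp
  | succ t ih =>
    rw [step_pow_succ', step_pow_succ' _ _ (gradSq h)]
    refine (gradSq_step_le hβ0 hβ1 _ σ).trans ?_
    rw [pow_succ', mul_assoc]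
    gcongr
    have := step_mono β (f := gradSq ((step β n ^ t) h))
      (g := ((1 + (1 + 4 * Real.exp 2) / n) ^ t : ℝ) • (step β n ^ t) (gradSq h))
      (fun η => by simpa using ih η) σ
    simpa using this

theorem variance_step_ge {β : ℝ} (hβ0 : 0 ≤ β) (hβ1 : β ≤ 1) {n : ℕ} [NeZero n]
    (h : Config n → ℝ) (σ : Config n) :
    (Real.exp (-2) / 2) ^ 2 / n * gradSq h σ / 2 ≤
      step β n (fun η => h η ^ 2) σ - step β n h σ ^ 2 := by
  have hn : (0 : ℝ) < n := by exact_mod_cast NeZero.pos n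
  set m := step β n h σ with hm
  have e : step β n (fun η => (h η - m) ^ 2) σ = step β n (fun η => h η ^ 2) σ - m ^ 2 := by
    have : (fun η => (h η - m) ^ 2) =
        (fun η => h η ^ 2) - (2 * m) • h + fun _ => m ^ 2 := by
      funext η; simp; ring
    rw [this, map_add, map_sub, map_smul, step_const]
    simp [← hm]
    ring
  rw [← e]
  have h1 := sum_flip_le_step hβ0 hβ1 (h := fun η => (h η - m) ^ 2) (fun _ => sq_nonneg _) σ
  have h2 := le_step_of_nonneg hβ0 hβ1 (h := fun η => (h η - m) ^ 2) (fun _ => sq_nonneg _) σ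
  set V := step β n (fun η => (h η - m) ^ 2) σ
  set c := Real.exp (-2) / 2 with hc
  have hc0 : 0 < c := by positivity
  have hc1 : c ≤ 1 / 2 := by
    have : Real.exp (-2) ≤ 1 := Real.exp_le_one_iff.2 (by norm_num)
    linarith
  -- `(x - y)² ≤ 2 (x - m)² + 2 (y - m)²` summed over the flips
  have h3 : gradSq h σ ≤ 2 * ∑ i, (h (flip i σ) - m) ^ 2 + 2 * (n * (h σ - m) ^ 2) := by
    have : (n : ℝ) * (h σ - m) ^ 2 = ∑ i : Fin n, (h σ - m) ^ 2 := by simp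
    rw [this, Finset.mul_sum, Finset.mul_sum, ← Finset.sum_add_distrib, gradSq]
    refine Finset.sum_le_sum fun i _ => ?_
    rw [← sq_flip_sub]
    nlinarith [sq_nonneg (h (flip i σ) - m + (h σ - m))]
  have h4 : c / n * gradSq h σ ≤ 4 * V := by
    calc c / n * gradSq h σ
        ≤ c / n * (2 * ∑ i, (h (flip i σ) - m) ^ 2 + 2 * (n * (h σ - m) ^ 2)) := by gcongr
      _ = 2 * (c / n * ∑ i, (h (flip i σ) - m) ^ 2) + 2 * (c * (h σ - m) ^ 2) := by field_simp
      _ ≤ 2 * V + 2 * V := by gcongr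
      _ = 4 * V := by ring
  have hV : 0 ≤ V := le_trans (by positivity) h2
  calc c ^ 2 / n * gradSq h σ / 2 = c / 2 * (c / n * gradSq h σ) := by ring
    _ ≤ c / 2 * (4 * V) := by gcongr
    _ ≤ V := by nlinarith

theorem one_add_div_pow_le {n k : ℕ} {C : ℝ} (hC : 0 ≤ C) (hk : k ≤ n) :
    (1 + C / n) ^ k ≤ Real.exp C := by
  rcases Nat.eq_zero_or_pos n with rfl | h
  · simpa [Nat.le_zero.1 hk] using hC
  have hn : (0 : ℝ) < n := by exact_mod_cast h
  have hk' : (k : ℝ) ≤ n := by exact_mod_cast hk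
  calc (1 + C / n) ^ k ≤ Real.exp (C / n) ^ k := by
        gcongr
        linarith [Real.add_one_le_exp (C / n)]
    _ = Real.exp (k * (C / n)) := by rw [← Real.exp_nat_mul]
    _ ≤ Real.exp C := by
        apply Real.exp_le_exp.2
        rw [mul_div_assoc', div_le_iff₀ hn]
        nlinarith

/-- The constant in the reverse Poincaré inequality. -/
noncomputable def poincareConst : ℝ :=
  2 * Real.exp (1 + 4 * Real.exp 2) / (Real.exp (-2) / 2) ^ 2

theorem poincareConst_pos : 0 < poincareConst := by unfold poincareConst; positivity

theorem gradSq_le_variance {β : ℝ} (hβ0 : 0 ≤ β) (hβ1 : β ≤ 1) {n : ℕ} [NeZero n] (t : ℕ)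
    (ht : t ≤ n) (f : Config n → ℝ) (σ : Config n) :
    (t + 1) / (n * poincareConst) * gradSq ((step β n ^ t) f) σ ≤
      (step β n ^ (t + 1)) (fun η => f η ^ 2) σ - (step β n ^ (t + 1)) f σ ^ 2 := by
  have hn : (0 : ℝ) < n := by exact_mod_cast NeZero.pos n
  have hM := poincareConst_pos
  set κ : ℝ := (Real.exp (-2) / 2) ^ 2 / n / 2 with hκ
  have hκ0 : 0 < κ := by positivity
  have hV (h : Config n → ℝ) (η : Config n) :
      κ * gradSq h η ≤ step β n (fun η => h η ^ 2) η - step β n h η ^ 2 := by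
    refine le_of_eq_of_le ?_ (variance_step_ge hβ0 hβ1 h η)
    rw [hκ]; ring
  have hK : 1 / (n * poincareConst) = κ / Real.exp (1 + 4 * Real.exp 2) := by
    rw [hκ, poincareConst]; field_simp
  -- the contribution of the first of the `t + 1` steps
  have hfirst (t : ℕ) (ht : t ≤ n) (f : Config n → ℝ) : 1 / (n * poincareConst) *
      gradSq ((step β n ^ t) f) σ ≤ (step β n ^ (t + 1)) (fun η => f η ^ 2) σ -
        (step β n ^ t) (fun η => step β n f η ^ 2) σ := by
    have h1 := step_pow_mono β t (f := κ • gradSq f)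
      (g := step β n (fun η => f η ^ 2) - fun η => step β n f η ^ 2)
      (fun η => by simpa using hV f η) σ
    rw [map_smul, map_sub, ← step_pow_succ] at h1
    have h2 := gradSq_step_pow_le hβ0 hβ1 f t σ
    have h3 : (1 + (1 + 4 * Real.exp 2) / n) ^ t ≤ Real.exp (1 + 4 * Real.exp 2) :=
      one_add_div_pow_le (by positivity) ht
    have h4 : 0 ≤ (step β n ^ t) (gradSq f) σ := by
      simpa using step_pow_mono β t (f := 0) (g := gradSq f) (gradSq_nonneg f) σ
    refine le_trans ?_ h1
    rw [hK, div_mul_eq_mul_div, div_le_iff₀ (Real.exp_pos _), Pi.smul_apply, smul_eq_mul, mul_assoc]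
    gcongr
    rw [mul_comm]
    exact h2.trans (mul_le_mul_of_nonneg_right h3 h4)
  induction t generalizing f with
  | zero =>
    have := hfirst 0 ht f
    simpa using this
  | succ t ih =>
    have h1 := hfirst (t + 1) ht f
    have h2 := ih (by lia) (step β n f)
    rw [← step_pow_succ, ← step_pow_succ] at h2
    push_cast
    have : ((t : ℝ) + 1 + 1) / (n * poincareConst) =
      (t + 1) / (n * poincareConst) + 1 / (n * poincareConst) := by ring
    rw [this, add_mul]
    linarith

/-- Reverse Poincaré inequality: after `n - 1` steps the gradient of a bounded observable is
bounded in the Euclidean norm, uniformly in `n`. -/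
theorem gradSq_step_pow_le_const {β : ℝ} (hβ0 : 0 ≤ β) (hβ1 : β ≤ 1) {n : ℕ} [NeZero n]
    {f : Config n → ℝ} (hf : ∀ σ, f σ ^ 2 ≤ 1) (σ : Config n) :
    gradSq ((step β n ^ (n - 1)) f) σ ≤ poincareConst := by
  have hn : (0 : ℝ) < n := by exact_mod_cast NeZero.pos n
  have hM := poincareConst_pos
  have h := gradSq_le_variance hβ0 hβ1 (n - 1) (Nat.sub_le _ _) f σ
  have e : n - 1 + 1 = n := Nat.sub_add_cancel (NeZero.pos n)
  have e' : ((n - 1 : ℕ) : ℝ) + 1 = n := by exact_mod_cast e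
  rw [e, e'] at h
  have h1 := step_pow_mono β n (f := fun η => f η ^ 2) (g := fun _ => 1) hf σ
  rw [step_pow_const] at h1
  have h2 : (n : ℝ) / (n * poincareConst) = 1 / poincareConst := by field_simp
  rw [h2, one_div, inv_mul_eq_div] at h
  have h3 : gradSq ((step β n ^ (n - 1)) f) σ / poincareConst ≤ 1 := by
    nlinarith [sq_nonneg ((step β n ^ n) f σ)]
  rwa [div_le_one hM] at h3

/-! ### Stationarity of the Gibbs measure -/

theorem two_mul_sum_Ioi_add {n : ℕ} (x : Fin n → ℝ) :
    2 * ∑ i, ∑ j ∈ Finset.Ioi i, x i * x j + ∑ i, x i ^ 2 = (∑ i, x i) ^ 2 := by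
  have h1 : ∑ i, ∑ j ∈ Finset.Iio i, x i * x j = ∑ i, ∑ j ∈ Finset.Ioi i, x i * x j := by
    rw [Finset.sum_comm' (t' := Finset.univ) (s' := fun j => Finset.Ioi j) (by simp)]
    exact Finset.sum_congr rfl fun i _ => Finset.sum_congr rfl fun j _ => mul_comm _ _
  have h2 (i : Fin n) : ∑ j, x i * x j =
      ∑ j ∈ Finset.Iio i, x i * x j + x i ^ 2 + ∑ j ∈ Finset.Ioi i, x i * x j := by
    have e : (Finset.univ.filter fun j => ¬ j < i) = insert i (Finset.Ioi i) := by
      ext j; simp [le_iff_eq_or_lt]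
    have e' : (Finset.univ.filter fun j => j < i) = Finset.Iio i := by
      ext j; simp
    rw [← Finset.sum_filter_add_sum_filter_not Finset.univ (fun j => j < i), e, e',
      Finset.sum_insert (by simp)]
    ring
  rw [sq (∑ i, x i), Finset.sum_mul_sum]
  simp only [h2, Finset.sum_add_distrib, h1]
  ring

theorem weight_eq (β : ℝ) {n : ℕ} (σ : Config n) :
    weight β n σ = Real.exp (β / n * ((mag σ ^ 2 - n) / 2)) := by
  have h := two_mul_sum_Ioi_add (spin σ)
  simp only [spin_sq, Finset.sum_const, Finset.card_univ, Fintype.card_fin, nsmul_eq_mul,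
    mul_one] at h
  rw [weight]
  congr 2
  rw [mag]
  linarith

theorem weight_pos (β : ℝ) {n : ℕ} (σ : Config n) : 0 < weight β n σ := Real.exp_pos _

theorem partition_pos (β : ℝ) (n : ℕ) : 0 < ∑ η : Config n, weight β n η :=
  Finset.sum_pos (fun η _ => weight_pos β η) Finset.univ_nonempty

theorem gibbs_nonneg (β : ℝ) {n : ℕ} (σ : Config n) : 0 ≤ gibbs β n σ :=
  div_nonneg (weight_pos β σ).le (partition_pos β n).le

theorem sum_gibbs (β : ℝ) (n : ℕ) : ∑ σ, gibbs β n σ = 1 := by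
  simp only [gibbs]
  rw [← Finset.sum_div, div_self (partition_pos β n).ne']

/-- Heat-bath form of the update rule: given the other spins, the new spin is distributed
according to the conditional Gibbs measure. -/
theorem weight_update (β : ℝ) {n : ℕ} (σ : Config n) (i : Fin n) (s : ℤˣ) :
    weight β n (Function.update σ i s) =
      (weight β n (Function.update σ i 1) + weight β n (Function.update σ i (-1))) *
        updateProb β σ i s := by
  have hn : (n : ℝ) ≠ 0 := by exact_mod_cast i.pos.ne'
  have key (s : ℤˣ) : weight β n (Function.update σ i s) =
      Real.exp (β / n * (((mag σ - spin σ i) ^ 2 + 1 - n) / 2)) *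
        Real.exp (β * ((s : ℤ) : ℝ) * localField σ i) := by
    rw [weight_eq, ← Real.exp_add, mag_update, localField_eq]
    congr 1
    have hs : ((s : ℤ) : ℝ) ^ 2 = 1 := by
      rcases Int.units_eq_one_or s with h | h <;> simp [h]
    field_simp
    linear_combination β * hs
  rw [key, key, key, updateProb, ← mul_add, mul_assoc]
  have h1 : Real.exp (β * (((1 : ℤˣ) : ℤ) : ℝ) * localField σ i) =
      Real.exp (β * localField σ i) := by simp
  have h2 : Real.exp (β * (((-1 : ℤˣ) : ℤ) : ℝ) * localField σ i) =
      Real.exp (-(β * localField σ i)) := by simp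
  rw [h1, h2]
  field_simp

theorem flip_flip {n : ℕ} (i : Fin n) (σ : Config n) : flip i (flip i σ) = σ := by
  simp [flip]

theorem sum_sum_update {n : ℕ} (i : Fin n) (f : Config n → ℝ) :
    ∑ σ, ∑ s, f (Function.update σ i s) = 2 * ∑ σ, f σ := by
  have h1 : ∑ σ, f (flip i σ) = ∑ σ, f σ :=
    Fintype.sum_equiv (Function.Involutive.toPerm (flip i) (flip_flip i)) _ _ fun _ => rfl
  have h2 (σ : Config n) : ∑ s, f (Function.update σ i s) = f σ + f (flip i σ) := by
    have e : Function.update σ i (σ i) = σ := Function.update_eq_self i σ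
    rcases Int.units_eq_one_or (σ i) with h | h <;> rw [h] at e <;>
      simp [e, flip, h, add_comm]
  simp only [h2]
  rw [Finset.sum_add_distrib, h1]
  ring

theorem sum_weight_mul_step (β : ℝ) {n : ℕ} [NeZero n] (h : Config n → ℝ) :
    ∑ σ, weight β n σ * step β n h σ = ∑ σ, weight β n σ * h σ := by
  have hn : (n : ℝ) ≠ 0 := NeZero.ne _
  have key (i : Fin n) :
      ∑ σ, weight β n σ * ∑ s, updateProb β σ i s * h (Function.update σ i s) =
        ∑ σ, weight β n σ * h σ := by
    -- both sides are resampled at `i`; there the inner average does not depend on the spin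
    have h1 := sum_sum_update i (fun σ => weight β n σ *
      ∑ s, updateProb β σ i s * h (Function.update σ i s))
    have h2 := sum_sum_update i (fun σ => weight β n σ * h σ)
    have h3 : ∑ σ, ∑ a, weight β n (Function.update σ i a) * ∑ s,
        updateProb β (Function.update σ i a) i s *
          h (Function.update (Function.update σ i a) i s) =
        ∑ σ, ∑ s, weight β n (Function.update σ i s) * h (Function.update σ i s) := by
      refine Finset.sum_congr rfl fun σ _ => ?_
      simp only [updateProb_update_self, Function.update_idem]
      rw [← Finset.sum_mul, sum_units (fun a => weight β n (Function.update σ i a)),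
        Finset.mul_sum]
      refine Finset.sum_congr rfl fun s _ => ?_
      rw [weight_update β σ i s]
      ring
    linarith
  simp only [step_apply]
  calc ∑ σ, weight β n σ *
        (1 / n * ∑ i, ∑ s, updateProb β σ i s * h (Function.update σ i s))
      = 1 / n * ∑ i, ∑ σ, weight β n σ *
          ∑ s, updateProb β σ i s * h (Function.update σ i s) := by
        rw [Finset.sum_comm, Finset.mul_sum]
        refine Finset.sum_congr rfl fun σ _ => ?_
        rw [← Finset.mul_sum]
        ring
    _ = _ := by
        simp only [key, Finset.sum_const, Finset.card_univ, Fintype.card_fin, nsmul_eq_mul]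
        field_simp

theorem sum_gibbs_mul_step (β : ℝ) {n : ℕ} [NeZero n] (h : Config n → ℝ) :
    ∑ σ, gibbs β n σ * step β n h σ = ∑ σ, gibbs β n σ * h σ := by
  simp only [gibbs, div_mul_eq_mul_div]
  rw [← Finset.sum_div, ← Finset.sum_div, sum_weight_mul_step]

theorem sum_gibbs_mul_step_pow (β : ℝ) {n : ℕ} [NeZero n] (t : ℕ) (h : Config n → ℝ) :
    ∑ σ, gibbs β n σ * (step β n ^ t) h σ = ∑ σ, gibbs β n σ * h σ := by
  induction t with
  | zero => rfl
  | succ t ih => rw [step_pow_succ', sum_gibbs_mul_step, ih]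

/-! ### Symmetrization over the permutations fixing the starting configuration -/

theorem mag_comp {n : ℕ} (σ : Config n) (π : Equiv.Perm (Fin n)) : mag (σ ∘ π) = mag σ :=
  Equiv.sum_comp π (spin σ)

theorem step_comp (β : ℝ) {n : ℕ} (h : Config n → ℝ) (π : Equiv.Perm (Fin n)) (σ : Config n) :
    step β n (fun η => h (η ∘ π)) σ = step β n h (σ ∘ π) := by
  rw [step_apply, step_apply]
  congr 1
  refine Fintype.sum_equiv π.symm _ _ fun i => Finset.sum_congr rfl fun s _ => ?_
  have h1 : updateProb β σ i s = updateProb β (σ ∘ π) (π.symm i) s := by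
    have : localField σ i = localField (σ ∘ π) (π.symm i) := by
      rw [localField_eq, localField_eq, mag_comp]
      simp [spin]
    rw [updateProb, updateProb, this]
  rw [h1, Function.update_comp_equiv]

theorem step_pow_comp (β : ℝ) {n : ℕ} (h : Config n → ℝ) (π : Equiv.Perm (Fin n)) (t : ℕ)
    (σ : Config n) :
    (step β n ^ t) (fun η => h (η ∘ π)) σ = (step β n ^ t) h (σ ∘ π) := by
  induction t generalizing σ with
  | zero => rfl
  | succ t ih =>
    rw [step_pow_succ', step_pow_succ', ← step_comp]
    exact congrFun (congrArg (step β n) (funext ih)) σ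

theorem sum_gibbs_mul_comp (β : ℝ) {n : ℕ} (h : Config n → ℝ) (π : Equiv.Perm (Fin n)) :
    ∑ σ, gibbs β n σ * h (σ ∘ π) = ∑ σ, gibbs β n σ * h σ := by
  refine Fintype.sum_equiv (Equiv.arrowCongr π.symm (Equiv.refl _)) _ _ fun σ => ?_
  have h1 : (Equiv.arrowCongr π.symm (Equiv.refl ℤˣ)) σ = σ ∘ π := by
    funext i; simp [Equiv.arrowCongr]
  rw [h1, gibbs, gibbs, weight_eq, weight_eq, mag_comp]

/-- The permutations of the vertices that fix the configuration `σ`. -/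
def fixing {n : ℕ} (σ : Config n) : Subgroup (Equiv.Perm (Fin n)) where
  carrier := {π | σ ∘ π = σ}
  mul_mem' {π ρ} hπ hρ := by
    rw [Set.mem_ofPred_eq] at *
    rw [Equiv.Perm.coe_mul, ← Function.comp_assoc, hπ, hρ]
  one_mem' := rfl
  inv_mem' {π} hπ := by
    rw [Set.mem_ofPred_eq] at *
    funext i
    simpa using (congrFun hπ (π⁻¹ i)).symm

open Classical in
/-- The average of an observable over the permutations that fix `σ₀`. -/
noncomputable def symmetrize {n : ℕ} (σ₀ : Config n) (f : Config n → ℝ) (σ : Config n) : ℝ :=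
  (Fintype.card (fixing σ₀) : ℝ)⁻¹ * ∑ π : fixing σ₀, f (σ ∘ π.1)

theorem symmetrize_comp {n : ℕ} (σ₀ : Config n) (f : Config n → ℝ) (σ : Config n)
    {ρ : Equiv.Perm (Fin n)} (hρ : σ₀ ∘ ρ = σ₀) :
    symmetrize σ₀ f (σ ∘ ρ) = symmetrize σ₀ f σ := by
  classical
  rw [symmetrize, symmetrize]
  congr 1
  exact Fintype.sum_equiv (Equiv.mulLeft (⟨ρ, hρ⟩ : fixing σ₀)) _ _ fun π => rfl

theorem step_pow_symmetrize (β : ℝ) {n : ℕ} (σ₀ : Config n) (f : Config n → ℝ) (t : ℕ) :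
    (step β n ^ t) (symmetrize σ₀ f) σ₀ = (step β n ^ t) f σ₀ := by
  classical
  have e : symmetrize σ₀ f = (Fintype.card (fixing σ₀) : ℝ)⁻¹ •
      ∑ π : fixing σ₀, fun σ => f (σ ∘ π.1) := by
    funext σ; simp [symmetrize]
  have h (π : fixing σ₀) : (step β n ^ t) (fun σ => f (σ ∘ π.1)) σ₀ = (step β n ^ t) f σ₀ := by
    rw [step_pow_comp, show σ₀ ∘ π.1 = σ₀ from π.2]
  rw [e, map_smul, map_sum, Pi.smul_apply, Finset.sum_apply]
  simp only [h]
  rw [Finset.sum_const, Finset.card_univ, nsmul_eq_mul, smul_eq_mul, inv_mul_cancel_left₀]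
  exact_mod_cast Fintype.card_ne_zero

theorem sum_gibbs_mul_symmetrize (β : ℝ) {n : ℕ} (σ₀ : Config n) (f : Config n → ℝ) :
    ∑ σ, gibbs β n σ * symmetrize σ₀ f σ = ∑ σ, gibbs β n σ * f σ := by
  classical
  have e (σ : Config n) : gibbs β n σ * symmetrize σ₀ f σ = (Fintype.card (fixing σ₀) : ℝ)⁻¹ *
      ∑ π : fixing σ₀, gibbs β n σ * f (σ ∘ π.1) := by
    rw [symmetrize, ← Finset.mul_sum]; ring
  simp only [e]
  rw [← Finset.mul_sum, Finset.sum_comm]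
  simp only [sum_gibbs_mul_comp]
  rw [Finset.sum_const, Finset.card_univ, nsmul_eq_mul, inv_mul_cancel_left₀]
  exact_mod_cast Fintype.card_ne_zero

theorem symmetrize_mem_Icc {n : ℕ} (σ₀ : Config n) {f : Config n → ℝ}
    (hf : ∀ σ, f σ ∈ Set.Icc 0 1) (σ : Config n) : symmetrize σ₀ f σ ∈ Set.Icc 0 1 := by
  classical
  have hc : (0 : ℝ) < Fintype.card (fixing σ₀) := by exact_mod_cast Fintype.card_pos
  rw [symmetrize]
  refine ⟨mul_nonneg (by positivity) (Finset.sum_nonneg fun _ _ => (hf _).1), ?_⟩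
  rw [inv_mul_le_iff₀ hc]
  refine (Finset.sum_le_sum fun _ _ => (hf _).2).trans ?_
  simp

/-- The vertices at which `σ₀` has the same spin as at `i`. -/
def sameSpin {n : ℕ} (σ₀ : Config n) (i : Fin n) : Finset (Fin n) :=
  Finset.univ.filter fun j => σ₀ j = σ₀ i

theorem grad_eq_of_invariant {n : ℕ} {σ₀ : Config n} {g : Config n → ℝ}
    (hg : ∀ (π : Equiv.Perm (Fin n)) σ, σ₀ ∘ π = σ₀ → g (σ ∘ π) = g σ) {i j : Fin n}
    (hij : σ₀ j = σ₀ i) {σ : Config n} (hσ : σ j = σ i) : grad j g σ = grad i g σ := by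
  have h0 : σ₀ ∘ Equiv.swap i j = σ₀ := by
    funext k
    rw [Function.comp_apply, Equiv.swap_apply_def]
    split_ifs with h1 h2
    · rw [h1, hij]
    · rw [h2, hij]
    · rfl
  have h1 (s : ℤˣ) : Function.update σ j s = Function.update σ i s ∘ Equiv.swap i j := by
    funext k
    rw [Function.comp_apply, Equiv.swap_apply_def]
    split_ifs with h1 h2
    · subst h1
      by_cases h : k = j
      · subst h; simp
      · rw [Function.update_of_ne h, Function.update_of_ne (Ne.symm h), hσ]
    · subst h2; simp
    · rw [Function.update_of_ne h2, Function.update_of_ne h1]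
  rw [grad, grad, h1, h1, hg _ _ h0, hg _ _ h0]

/-- For an observable invariant under the permutations fixing `σ₀`, a bound on the Euclidean
length of the gradient improves to a bound on each partial derivative: the derivative at `i` is
shared by all vertices of `sameSpin σ₀ i` whose current spin agrees with the one at `i`, and after
the spin at `i` is reversed these are the remaining ones. -/
theorem card_mul_grad_sq_le {n : ℕ} {σ₀ : Config n} {g : Config n → ℝ}
    (hg : ∀ (π : Equiv.Perm (Fin n)) σ, σ₀ ∘ π = σ₀ → g (σ ∘ π) = g σ) {M : ℝ}
    (hM : ∀ σ, gradSq g σ ≤ M) (i : Fin n) (σ : Config n) :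
    (sameSpin σ₀ i).card * grad i g σ ^ 2 ≤ 2 * M := by
  set B : ℤˣ → Finset (Fin n) := fun s =>
    (sameSpin σ₀ i).filter fun j => Function.update σ i s j = s with hB
  have h1 (s : ℤˣ) : ((B s).card : ℝ) * grad i g σ ^ 2 ≤ M := by
    refine le_trans ?_ (hM (Function.update σ i s))
    calc ((B s).card : ℝ) * grad i g σ ^ 2
        = ∑ j ∈ B s, grad j g (Function.update σ i s) ^ 2 := by
          rw [← nsmul_eq_mul, ← Finset.sum_const]
          refine Finset.sum_congr rfl fun j hj => ?_
          rw [hB, Finset.mem_filter, sameSpin, Finset.mem_filter] at hj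
          rw [grad_eq_of_invariant hg hj.1.2 (by rw [hj.2]; simp), grad_update_self]
      _ ≤ _ := Finset.sum_le_sum_of_subset_of_nonneg (Finset.subset_univ _)
          fun _ _ _ => sq_nonneg _
  have h2 : (sameSpin σ₀ i).card ≤ (B 1).card + (B (-1)).card := by
    refine (Finset.card_le_card fun j hj => ?_).trans (Finset.card_union_le _ _)
    rw [Finset.mem_union, hB, Finset.mem_filter, Finset.mem_filter]
    by_cases h : j = i
    · left; subst h; simp [hj]
    · rw [Function.update_of_ne h, Function.update_of_ne h]
      rcases Int.units_eq_one_or (σ j) with h | h <;> simp [hj, h]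
  have h3 : ((sameSpin σ₀ i).card : ℝ) ≤ (B 1).card + (B (-1)).card := by exact_mod_cast h2
  nlinarith [h1 1, h1 (-1), sq_nonneg (grad i g σ)]

theorem sum_inv_card_sameSpin_le {n : ℕ} (σ₀ : Config n) :
    ∑ i, ((sameSpin σ₀ i).card : ℝ)⁻¹ ≤ 2 := by
  have h (s : ℤˣ) : ∑ i ∈ Finset.univ.filter (fun i => σ₀ i = s),
      ((sameSpin σ₀ i).card : ℝ)⁻¹ ≤ 1 := by
    have e : ∑ i ∈ Finset.univ.filter (fun i => σ₀ i = s), ((sameSpin σ₀ i).card : ℝ)⁻¹ =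
        ∑ i ∈ Finset.univ.filter (fun i => σ₀ i = s),
          ((Finset.univ.filter (fun i => σ₀ i = s)).card : ℝ)⁻¹ := by
      refine Finset.sum_congr rfl fun i hi => ?_
      rw [sameSpin, (Finset.mem_filter.1 hi).2]
    rw [e, Finset.sum_const, nsmul_eq_mul]
    exact mul_inv_le_one
  rw [← Finset.sum_fiberwise Finset.univ σ₀, sum_units]
  linarith [h 1, h (-1)]

/-! ### Upper bound on the distance to stationarity -/

theorem sum_law_eq (β : ℝ) {n : ℕ} (t : ℕ) (σ : Config n) (A : Finset (Config n)) :
    ∑ η ∈ A, law β n t σ η = (step β n ^ t) (Set.indicator A 1) σ := by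
  classical
  rw [step_pow_apply]
  simp [Set.indicator_apply]

theorem sum_gibbs_eq (β : ℝ) {n : ℕ} (A : Finset (Config n)) :
    ∑ η ∈ A, gibbs β n η = ∑ η, gibbs β n η * Set.indicator (A : Set (Config n)) 1 η := by
  classical
  simp [Set.indicator_apply]

theorem indicator_mem_Icc {n : ℕ} (A : Finset (Config n)) (σ : Config n) :
    Set.indicator (A : Set (Config n)) (1 : Config n → ℝ) σ ∈ Set.Icc 0 1 := by
  classical
  rw [Set.indicator_apply]
  split_ifs <;> simp

theorem dist_le {β : ℝ} (hβ0 : 0 ≤ β) (hβ1 : β ≤ 1) {n : ℕ} [NeZero n] (t : ℕ) :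
    dist β n (t + (n - 1)) ≤ (1 - (1 - β) / n) ^ t * (2 * √(poincareConst * n)) := by
  refine Finset.sup'_le _ _ fun σ₀ _ => Finset.sup'_le _ _ fun A _ => ?_
  have hM := poincareConst_pos
  have hn : (0 : ℝ) < n := by exact_mod_cast NeZero.pos n
  set f := symmetrize σ₀ (Set.indicator A 1) with hf
  set g := (step β n ^ (n - 1)) f with hg
  have hf1 (σ : Config n) : f σ ^ 2 ≤ 1 := by
    obtain ⟨h0, h1⟩ := symmetrize_mem_Icc σ₀ (indicator_mem_Icc A) σ
    exact pow_le_one₀ h0 h1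
  have hginv (π : Equiv.Perm (Fin n)) (σ : Config n) (hπ : σ₀ ∘ π = σ₀) : g (σ ∘ π) = g σ := by
    rw [hg, ← step_pow_comp]
    simp only [hf, symmetrize_comp σ₀ _ _ hπ]
  set L : Fin n → ℝ := fun i => √(2 * poincareConst / (sameSpin σ₀ i).card) with hL
  have hgrad (i : Fin n) (σ : Config n) : |grad i g σ| ≤ L i := by
    have hc : (0 : ℝ) < (sameSpin σ₀ i).card := by
      exact_mod_cast Finset.card_pos.2 ⟨i, by simp [sameSpin]⟩
    apply Real.abs_le_sqrt
    rw [le_div_iff₀ hc, mul_comm]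
    exact card_mul_grad_sq_le hginv (gradSq_step_pow_le_const hβ0 hβ1 hf1) i σ
  have hsum : ∑ i, L i ≤ 2 * √(poincareConst * n) := by
    have h1 : (∑ i, L i) ^ 2 ≤ 4 * (poincareConst * n) := by
      refine sq_sum_le_card_mul_sum_sq.trans ?_
      have h2 : ∑ i, L i ^ 2 ≤ 2 * poincareConst * 2 := by
        simp only [hL]
        rw [Finset.sum_congr rfl fun i _ => Real.sq_sqrt (by positivity)]
        simp only [div_eq_mul_inv]
        rw [← Finset.mul_sum]
        gcongr
        exact sum_inv_card_sameSpin_le σ₀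
      rw [Finset.card_univ, Fintype.card_fin]
      nlinarith
    have h3 := Real.le_sqrt_of_sq_le h1
    rwa [Real.sqrt_mul (by norm_num), show √(4 : ℝ) = 2 by
      rw [show (4 : ℝ) = 2 ^ 2 by norm_num]; exact Real.sqrt_sq (by norm_num)] at h3
  obtain ⟨L', h1, h2⟩ := exists_grad_step_pow_le hβ0 hgrad t
  set F := (step β n ^ t) g with hF
  have hFe : F = (step β n ^ (t + (n - 1))) f := by
    rw [hF, hg, pow_add, Module.End.mul_apply]
  have e1 : ∑ η ∈ A, law β n (t + (n - 1)) σ₀ η = F σ₀ := by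
    rw [sum_law_eq, hFe, hf, step_pow_symmetrize]
  have e2 : ∑ η ∈ A, gibbs β n η = ∑ η, gibbs β n η * F η := by
    rw [sum_gibbs_eq, hFe, sum_gibbs_mul_step_pow, hf, sum_gibbs_mul_symmetrize]
  have e3 : F σ₀ - ∑ η, gibbs β n η * F η = ∑ η, gibbs β n η * (F σ₀ - F η) := by
    simp only [mul_sub]
    rw [Finset.sum_sub_distrib, ← Finset.sum_mul, sum_gibbs, one_mul]
  rw [e1, e2, e3]
  calc |∑ η, gibbs β n η * (F σ₀ - F η)| ≤ ∑ η, |gibbs β n η * (F σ₀ - F η)| :=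
        Finset.abs_sum_le_sum_abs _ _
    _ ≤ ∑ η, gibbs β n η * ∑ i, L' i := by
        gcongr with η _
        rw [abs_mul, abs_of_nonneg (gibbs_nonneg β η)]
        gcongr
        · exact gibbs_nonneg β η
        · exact abs_sub_le_sum_grad h1 η σ₀
    _ = (1 - (1 - β) / n) ^ t * ∑ i, L i := by rw [← Finset.sum_mul, sum_gibbs, one_mul, h2]
    _ ≤ _ := by
        gcongr
        exact pow_nonneg (rate_nonneg hβ0 n) t

/-! ### Moments of the magnetization -/

theorem grad_mag {n : ℕ} (i : Fin n) (σ : Config n) : grad i mag σ = 2 := by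
  rw [grad, mag_update, mag_update]
  push_cast
  ring

theorem step_mag (β : ℝ) {n : ℕ} [NeZero n] (σ : Config n) :
    step β n mag σ =
      mag σ - mag σ / n + (1 / n : ℝ) * ∑ i, Real.tanh (β * localField σ i) := by
  have hn : (n : ℝ) ≠ 0 := NeZero.ne _
  have h (i : Fin n) : ∑ s, updateProb β σ i s * mag (Function.update σ i s) =
      mag σ - spin σ i + Real.tanh (β * localField σ i) := by
    rw [sum_units, ← updateProb_sub]
    simp only [mag_update]
    push_cast
    linear_combination (mag σ - spin σ i) * updateProb_add β σ i
  rw [step_apply]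
  simp only [h]
  rw [Finset.sum_add_distrib, Finset.sum_sub_distrib, ← mag, Finset.sum_const, Finset.card_univ,
    Fintype.card_fin, nsmul_eq_mul]
  field_simp

theorem abs_localField_le_mag {n : ℕ} (σ : Config n) (i : Fin n) :
    |localField σ i| ≤ (|mag σ| + 1) / n := by
  rw [localField_eq, abs_div, Nat.abs_cast]
  gcongr
  exact (abs_sub _ _).trans (by rw [abs_spin])

theorem step_mag_sq_le {β : ℝ} (hβ0 : 0 ≤ β) (hβ1 : β ≤ 1) {n : ℕ} [NeZero n] (σ : Config n) :
    step β n (fun η => mag η ^ 2) σ ≤ (1 - (1 - β) / n) ^ 2 * mag σ ^ 2 + 6 := by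
  have hn : (0 : ℝ) < n := by exact_mod_cast NeZero.pos n
  have hS := abs_mag_le σ
  have h (i : Fin n) : ∑ s, updateProb β σ i s * mag (Function.update σ i s) ^ 2 ≤
      mag σ ^ 2 + 2 * (β * (mag σ ^ 2 + |mag σ|) / n) - 2 * mag σ * spin σ i + 4 := by
    have h1 : ∑ s, updateProb β σ i s * mag (Function.update σ i s) ^ 2 =
        mag σ ^ 2 + 2 * (mag σ * Real.tanh (β * localField σ i)) - 2 * mag σ * spin σ i +
          2 * (1 - spin σ i * Real.tanh (β * localField σ i)) := by
      rw [sum_units, ← updateProb_sub]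
      simp only [mag_update]
      push_cast
      have hs := spin_sq σ i
      linear_combination (mag σ ^ 2 - 2 * mag σ * spin σ i + spin σ i ^ 2 + 1) *
        updateProb_add β σ i + hs
    have h2 : mag σ * Real.tanh (β * localField σ i) ≤ β * (mag σ ^ 2 + |mag σ|) / n := by
      refine (le_abs_self _).trans ?_
      rw [abs_mul]
      calc |mag σ| * |Real.tanh (β * localField σ i)|
          ≤ |mag σ| * (β * ((|mag σ| + 1) / n)) := by
            gcongr
            refine (abs_tanh_le _).trans ?_
            rw [abs_mul, abs_of_nonneg hβ0]
            gcongr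
            exact abs_localField_le_mag σ i
        _ = _ := by rw [← sq_abs (mag σ)]; ring
    have h3 : -(spin σ i * Real.tanh (β * localField σ i)) ≤ 1 := by
      refine (neg_le_abs _).trans ?_
      rw [abs_mul, abs_spin, one_mul, ← sq_le_one_iff_abs_le_one]
      exact tanh_sq_le_one _
    rw [h1]
    linarith
  rw [step_apply]
  calc (1 / n : ℝ) * ∑ i, ∑ s, updateProb β σ i s * mag (Function.update σ i s) ^ 2
      ≤ (1 / n : ℝ) * ∑ i, (mag σ ^ 2 + 2 * (β * (mag σ ^ 2 + |mag σ|) / n) -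
          2 * mag σ * spin σ i + 4) := by
        gcongr with i _
        exact h i
    _ = mag σ ^ 2 + 2 * (β * (mag σ ^ 2 + |mag σ|) / n) - 2 * mag σ ^ 2 / n + 4 := by
        rw [Finset.sum_add_distrib, Finset.sum_sub_distrib, ← Finset.mul_sum, ← mag]
        simp only [Finset.sum_const, Finset.card_univ, Fintype.card_fin, nsmul_eq_mul]
        field_simp
    _ = (1 - 2 * ((1 - β) / n)) * mag σ ^ 2 + 2 * (β * (|mag σ| / n)) + 4 := by ring
    _ ≤ (1 - (1 - β) / n) ^ 2 * mag σ ^ 2 + 2 * (1 * 1) + 4 := by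
        gcongr
        · nlinarith [sq_nonneg ((1 - β) / n)]
        · exact (div_le_one hn).2 hS
    _ = _ := by ring

theorem one_sub_rate_sq_ge {β : ℝ} (hβ0 : 0 ≤ β) (hβ1 : β ≤ 1) (n : ℕ) :
    (1 - β) / n ≤ 1 - (1 - (1 - β) / n) ^ 2 := by
  have h1 := rate_nonneg hβ0 n
  have h2 : 0 ≤ (1 - β) / n := div_nonneg (by linarith) (Nat.cast_nonneg n)
  nlinarith

theorem step_pow_mag_sq_le {β : ℝ} (hβ0 : 0 ≤ β) (hβ1 : β < 1) {n : ℕ} [NeZero n] (t : ℕ)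
    (σ : Config n) :
    (step β n ^ t) (fun η => mag η ^ 2) σ ≤
      ((1 - (1 - β) / n) ^ t) ^ 2 * mag σ ^ 2 + 6 * n / (1 - β) := by
  have hn : (0 : ℝ) < n := by exact_mod_cast NeZero.pos n
  have hb : 0 < 1 - β := by linarith
  have hr := one_sub_rate_sq_ge hβ0 hβ1.le n
  set r := 1 - (1 - β) / n
  induction t with
  | zero =>
    have : 0 ≤ 6 * n / (1 - β) := by positivity
    simpa using this
  | succ t ih =>
    have h1 := step_pow_mono β t (f := step β n fun η => mag η ^ 2)
      (g := (r ^ 2) • (fun η => mag η ^ 2) + fun _ => 6)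
      (fun η => by simpa using step_mag_sq_le hβ0 hβ1.le η) σ
    rw [map_add, map_smul, step_pow_const] at h1
    rw [step_pow_succ]
    refine h1.trans ?_
    have h2 : 6 ≤ (1 - r ^ 2) * (6 * n / (1 - β)) := by
      calc (6 : ℝ) = (1 - β) / n * (6 * n / (1 - β)) := by field_simp
        _ ≤ _ := by gcongr
    calc r ^ 2 * (step β n ^ t) (fun η => mag η ^ 2) σ + 6
        ≤ r ^ 2 * ((r ^ t) ^ 2 * mag σ ^ 2 + 6 * n / (1 - β)) + 6 := by gcongr
      _ ≤ _ := by rw [show (r ^ (t + 1)) ^ 2 = r ^ 2 * (r ^ t) ^ 2 by ring]; linarith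

theorem sum_gibbs_mul_mag_sq_le {β : ℝ} (hβ0 : 0 ≤ β) (hβ1 : β < 1) {n : ℕ} [NeZero n] :
    ∑ σ, gibbs β n σ * mag σ ^ 2 ≤ 6 * n / (1 - β) := by
  have hn : (0 : ℝ) < n := by exact_mod_cast NeZero.pos n
  have hb : 0 < 1 - β := by linarith
  have hr := one_sub_rate_sq_ge hβ0 hβ1.le n
  have h0 : 0 ≤ ∑ σ, gibbs β n σ * mag σ ^ 2 :=
    Finset.sum_nonneg fun σ _ => mul_nonneg (gibbs_nonneg β σ) (sq_nonneg _)
  have h1 : ∑ σ, gibbs β n σ * mag σ ^ 2 ≤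
      (1 - (1 - β) / n) ^ 2 * ∑ σ, gibbs β n σ * mag σ ^ 2 + 6 := by
    conv_lhs => rw [← sum_gibbs_mul_step β fun σ : Config n => mag σ ^ 2]
    calc _ ≤ ∑ σ, gibbs β n σ * ((1 - (1 - β) / n) ^ 2 * mag σ ^ 2 + 6) := by
          gcongr with σ _
          · exact gibbs_nonneg β σ
          · exact step_mag_sq_le hβ0 hβ1.le σ
      _ = _ := by
          simp only [mul_add]
          rw [Finset.sum_add_distrib, ← Finset.sum_mul, sum_gibbs, Finset.mul_sum, one_mul]
          congr 1
          exact Finset.sum_congr rfl fun _ _ => by ring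
  have h2 : (1 - β) / n * ∑ σ, gibbs β n σ * mag σ ^ 2 ≤ 6 := by nlinarith
  rw [le_div_iff₀ hb]
  rw [div_mul_eq_mul_div, div_le_iff₀ hn] at h2
  linarith

theorem step_mag_ge {β : ℝ} (hβ0 : 0 ≤ β) (hβ1 : β ≤ 1) {n : ℕ} [NeZero n] (σ : Config n) :
    (1 - (1 - β) / n) * mag σ - 2 / n ^ 2 * mag σ ^ 2 - 3 / n ≤ step β n mag σ := by
  have hn : (0 : ℝ) < n := by exact_mod_cast NeZero.pos n
  have hn1 : (1 : ℝ) ≤ n := by exact_mod_cast NeZero.pos n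
  have h1 (i : Fin n) : β * localField σ i - 2 * (mag σ ^ 2 + 1) / n ^ 2 ≤
      Real.tanh (β * localField σ i) := by
    have h2 := (abs_le.1 (abs_tanh_sub_self_le (β * localField σ i))).1
    have h3 : (β * localField σ i) ^ 2 ≤ 2 * (mag σ ^ 2 + 1) / n ^ 2 := by
      calc (β * localField σ i) ^ 2 = β ^ 2 * |localField σ i| ^ 2 := by rw [sq_abs]; ring
        _ ≤ 1 ^ 2 * ((|mag σ| + 1) / n) ^ 2 := by
            gcongr
            exact abs_localField_le_mag σ i
        _ ≤ _ := by
            rw [one_pow, one_mul, div_pow]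
            gcongr
            rw [← sq_abs (mag σ)]
            nlinarith [sq_nonneg (|mag σ| - 1)]
    linarith
  have h2 : ∑ i, localField σ i = mag σ - mag σ / n := by
    simp only [localField_eq]
    rw [← Finset.sum_div, Finset.sum_sub_distrib, ← mag]
    simp only [Finset.sum_const, Finset.card_univ, Fintype.card_fin, nsmul_eq_mul]
    field_simp
  have h3 : β * (mag σ - mag σ / n) - n * (2 * (mag σ ^ 2 + 1) / n ^ 2) ≤
      ∑ i, Real.tanh (β * localField σ i) := by
    refine le_trans (le_of_eq ?_) (Finset.sum_le_sum fun i _ => h1 i)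
    rw [Finset.sum_sub_distrib, ← Finset.mul_sum, h2]
    simp
  have h4 : β * mag σ ≤ n := by
    have := (le_abs_self _).trans (abs_mag_le σ)
    nlinarith [abs_nonneg (mag σ)]
  rw [step_mag]
  calc (1 - (1 - β) / n) * mag σ - 2 / n ^ 2 * mag σ ^ 2 - 3 / n
      = mag σ - mag σ / n + β * mag σ / n - 2 * mag σ ^ 2 / n ^ 2 - n / n ^ 2 - 2 * n / n ^ 2 := by
        field_simp; ring
    _ ≤ mag σ - mag σ / n + β * mag σ / n - 2 * mag σ ^ 2 / n ^ 2 - β * mag σ / n ^ 2 -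
          2 * 1 / n ^ 2 := by gcongr
    _ = mag σ - mag σ / n + (1 / n : ℝ) *
          (β * (mag σ - mag σ / n) - n * (2 * (mag σ ^ 2 + 1) / n ^ 2)) := by
        field_simp; ring
    _ ≤ _ := by gcongr

/-- The expected magnetization decays no faster than `(1 - (1 - β) / n) ^ t`, up to a constant
factor, as long as the initial magnetization is a small multiple of `n` and the result is not of
constant order. -/
theorem step_pow_mag_ge {β : ℝ} (hβ0 : 0 ≤ β) (hβ1 : β < 1) {n : ℕ} (hn2 : 2 ≤ n) [NeZero n]
    (t : ℕ) (σ : Config n) :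
    (1 - (1 - β) / n) ^ t * (mag σ - 4 * mag σ ^ 2 / (n * (1 - β))) - 15 / (1 - β) ^ 2 ≤
      (step β n ^ t) mag σ := by
  have hn : (2 : ℝ) ≤ n := by exact_mod_cast hn2
  have hb : 0 < 1 - β := by linarith
  have hr0 := rate_nonneg hβ0 n
  have hr1 : 1 / 2 ≤ 1 - (1 - β) / n := by
    have : (1 - β) / n ≤ 1 / 2 := by rw [div_le_div_iff₀ (by linarith) (by norm_num)]; linarith
    linarith
  have hr2 : 1 - (1 - β) / n ≤ 1 := by
    have : 0 ≤ (1 - β) / n := by positivity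
    linarith
  have hra : 1 - (1 - (1 - β) / n) = (1 - β) / n := by ring
  have hsq (t : ℕ) := step_pow_mag_sq_le hβ0 hβ1 t σ
  set r := 1 - (1 - β) / n with hr
  set D := 4 * mag σ ^ 2 / (n * (1 - β)) with hD
  set E := 15 / (1 - β) ^ 2 with hE
  have hD0 : 0 ≤ D := by positivity
  -- the error made by linearizing the drift sums to at most `r ^ t * (1 - r ^ t) * D + E`
  have key : r ^ t * mag σ - r ^ t * (1 - r ^ t) * D - E ≤ (step β n ^ t) mag σ := by
    induction t with
    | zero =>
      have : 0 ≤ E := by positivity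
      simpa using this
    | succ t ih =>
      have h1 := step_pow_mono β t (f := r • (mag : Config n → ℝ) -
        (2 / n ^ 2 : ℝ) • (fun η => mag η ^ 2) - fun _ => (3 / n : ℝ)) (g := step β n mag)
        (fun η => by simpa using step_mag_ge hβ0 hβ1.le η) σ
      rw [map_sub, map_sub, map_smul, map_smul, step_pow_const, ← step_pow_succ] at h1
      refine le_trans ?_ h1
      simp only [Pi.sub_apply, Pi.smul_apply, smul_eq_mul]
      have h2 : 2 / n ^ 2 * (step β n ^ t) (fun η => mag η ^ 2) σ ≤
          2 / n ^ 2 * ((r ^ t) ^ 2 * mag σ ^ 2 + 6 * n / (1 - β)) := by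
        gcongr
        exact hsq t
      have h3 : 2 / n ^ 2 * ((r ^ t) ^ 2 * mag σ ^ 2) ≤ (r ^ t) ^ 2 * (r * (1 - r) * D) := by
        calc 2 / n ^ 2 * ((r ^ t) ^ 2 * mag σ ^ 2)
            = (r ^ t) ^ 2 * (1 / 2 * ((1 - β) / n) * D) := by rw [hD]; field_simp; ring
          _ ≤ (r ^ t) ^ 2 * (r * ((1 - β) / n) * D) := by gcongr
          _ = _ := by rw [hra]
      have h4 : 2 / n ^ 2 * (6 * n / (1 - β)) + 3 / n ≤ (1 - r) * E := by
        calc 2 / n ^ 2 * (6 * n / (1 - β)) + 3 / n = (12 + 3 * (1 - β)) / (n * (1 - β)) := by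
              field_simp
              ring
          _ ≤ 15 / (n * (1 - β)) := by gcongr; linarith
          _ = _ := by rw [hra, hE]; field_simp
      have h5 : r * (r ^ t * mag σ - r ^ t * (1 - r ^ t) * D - E) ≤
          r * (step β n ^ t) mag σ := by gcongr
      have h6 : r ^ (t + 1) * mag σ - r ^ (t + 1) * (1 - r ^ (t + 1)) * D - E =
          r * (r ^ t * mag σ - r ^ t * (1 - r ^ t) * D - E) - (r ^ t) ^ 2 * (r * (1 - r) * D) -
            (1 - r) * E := by
        rw [pow_succ]; ring
      linarith
  have h7 : 0 ≤ (r ^ t) ^ 2 * D := by positivity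
  nlinarith

theorem variance_step_le (β : ℝ) {n : ℕ} [NeZero n] {h : Config n → ℝ} {c : ℝ}
    (hc : ∀ i σ, |grad i h σ| ≤ c) (σ : Config n) :
    step β n (fun η => h η ^ 2) σ - step β n h σ ^ 2 ≤ c ^ 2 := by
  have hn : (n : ℝ) ≠ 0 := NeZero.ne _
  set m := h σ with hm
  have e : step β n (fun η => (h η - m) ^ 2) σ =
      step β n (fun η => h η ^ 2) σ - 2 * m * step β n h σ + m ^ 2 := by
    have : (fun η => (h η - m) ^ 2) =
        (fun η => h η ^ 2) - (2 * m) • h + fun _ => m ^ 2 := by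
      funext η; simp; ring
    rw [this, map_add, map_sub, map_smul, step_const]
    simp
  have h1 : step β n (fun η => (h η - m) ^ 2) σ ≤ c ^ 2 := by
    rw [step_apply]
    calc _ ≤ (1 / n : ℝ) * ∑ i : Fin n, ∑ s, updateProb β σ i s * c ^ 2 := by
          refine mul_le_mul_of_nonneg_left (Finset.sum_le_sum fun i _ => Finset.sum_le_sum
            fun s _ => mul_le_mul_of_nonneg_left ?_ (updateProb_pos β σ i s).le) (by positivity)
          obtain ⟨h1, h2⟩ := abs_le.1 ((abs_update_sub_le i h σ s).trans (hc i σ))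
          exact sq_le_sq' h1 h2
      _ = c ^ 2 := by
          simp only [sum_units, ← add_mul, updateProb_add]
          simp [hn]
  nlinarith [sq_nonneg (step β n h σ - m)]

theorem variance_step_pow_le {β : ℝ} (hβ0 : 0 ≤ β) (hβ1 : β < 1) {n : ℕ} [NeZero n]
    {h : Config n → ℝ} {c : ℝ} (hc : ∀ i σ, |grad i h σ| ≤ c) (t : ℕ) (σ : Config n) :
    (step β n ^ t) (fun η => h η ^ 2) σ - (step β n ^ t) h σ ^ 2 ≤ c ^ 2 * (n / (1 - β)) := by
  have hn : (0 : ℝ) < n := by exact_mod_cast NeZero.pos n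
  have hb : 0 < 1 - β := by linarith
  induction t generalizing h c with
  | zero =>
    have : 0 ≤ c ^ 2 * (n / (1 - β)) := by positivity
    simpa using this
  | succ t ih =>
    have h1 := step_pow_mono β t (f := step β n (fun η => h η ^ 2) - fun η => step β n h η ^ 2)
      (g := fun _ => c ^ 2) (fun η => by simpa using variance_step_le β hc η) σ
    rw [map_sub, step_pow_const, ← step_pow_succ] at h1
    have h2 := ih (h := step β n h) (c := (1 - (1 - β) / n) * c)
      fun i η => by simpa using abs_grad_step_pow_le hβ0 hc 1 i η
    rw [← step_pow_succ] at h2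
    simp only [Pi.sub_apply] at h1
    have h3 : 1 ≤ (1 - (1 - (1 - β) / n) ^ 2) * (n / (1 - β)) := by
      calc (1 : ℝ) = (1 - β) / n * (n / (1 - β)) := by field_simp
        _ ≤ _ := by
          gcongr
          exact one_sub_rate_sq_ge hβ0 hβ1.le n
    have h4 := mul_le_mul_of_nonneg_left h3 (sq_nonneg c)
    rw [mul_pow] at h2
    nlinarith

/-! ### Lower bound on the distance to stationarity -/

/-- Chebyshev's inequality separates the law of the magnetization at time `t` from its law in
equilibrium as soon as the mean at time `t` exceeds the order `√n` of the fluctuations. -/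
theorem le_dist {β : ℝ} (hβ0 : 0 ≤ β) (hβ1 : β < 1) {n : ℕ} [NeZero n] (t : ℕ) (σ : Config n)
    (hpos : 0 < (step β n ^ t) mag σ) :
    1 - 40 * n / ((1 - β) * (step β n ^ t) mag σ ^ 2) ≤ dist β n t := by
  classical
  have hn : (0 : ℝ) < n := by exact_mod_cast NeZero.pos n
  have hb : 0 < 1 - β := by linarith
  have hvar := variance_step_pow_le hβ0 hβ1 (c := 2) (h := mag (n := n))
    (fun i σ => by rw [grad_mag, abs_two]) t σ
  set x := (step β n ^ t) mag σ with hx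
  set A : Finset (Config n) := Finset.univ.filter fun η => x / 2 ≤ mag η with hA
  have hlaw : 1 - 16 * n / ((1 - β) * x ^ 2) ≤ ∑ η ∈ A, law β n t σ η := by
    rw [sum_law_eq]
    have h1 := step_pow_mono β t
      (f := (fun _ => (1 : ℝ)) - (4 / x ^ 2) • ((fun η => mag η ^ 2) - (2 * x) • mag +
        fun _ => x ^ 2)) (g := Set.indicator (A : Set (Config n)) 1) (fun η => by
          simp only [Pi.sub_apply, Pi.add_apply, Pi.smul_apply, smul_eq_mul, Set.indicator_apply]
          have h2 : mag η ^ 2 - 2 * x * mag η + x ^ 2 = (mag η - x) ^ 2 := by ring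
          rw [h2]
          split_ifs with h
          · have : 0 ≤ 4 / x ^ 2 * (mag η - x) ^ 2 := by positivity
            simpa using this
          · have h3 : mag η < x / 2 := by simpa [hA] using h
            have h4 : 1 ≤ 4 / x ^ 2 * (mag η - x) ^ 2 := by
              rw [div_mul_eq_mul_div, one_le_div (by positivity)]
              nlinarith
            linarith) σ
    rw [map_sub, map_smul, map_add, map_sub, map_smul, step_pow_const, step_pow_const] at h1
    refine le_trans ?_ h1
    simp only [Pi.sub_apply, Pi.add_apply, Pi.smul_apply, smul_eq_mul]
    rw [← hx]
    have h5 : 4 / x ^ 2 * ((step β n ^ t) (fun η => mag η ^ 2) σ - 2 * x * x + x ^ 2) ≤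
        4 / x ^ 2 * (2 ^ 2 * (n / (1 - β))) := by
      gcongr
      linarith
    have h6 : 4 / x ^ 2 * (2 ^ 2 * (n / (1 - β))) = 16 * n / ((1 - β) * x ^ 2) := by
      field_simp; norm_num
    linarith
  have hgibbs : ∑ η ∈ A, gibbs β n η ≤ 24 * n / ((1 - β) * x ^ 2) := by
    calc ∑ η ∈ A, gibbs β n η ≤ ∑ η ∈ A, 4 / x ^ 2 * (gibbs β n η * mag η ^ 2) := by
          gcongr with η hη
          have h1 : x / 2 ≤ mag η := by simpa [hA] using hη
          have h2 : 1 ≤ 4 / x ^ 2 * mag η ^ 2 := by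
            rw [div_mul_eq_mul_div, one_le_div (by positivity)]
            nlinarith
          nlinarith [gibbs_nonneg β η]
      _ ≤ ∑ η, 4 / x ^ 2 * (gibbs β n η * mag η ^ 2) :=
          Finset.sum_le_sum_of_subset_of_nonneg (Finset.subset_univ _) fun η _ _ =>
            mul_nonneg (by positivity) (mul_nonneg (gibbs_nonneg β η) (sq_nonneg _))
      _ = 4 / x ^ 2 * ∑ η, gibbs β n η * mag η ^ 2 := by rw [Finset.mul_sum]
      _ ≤ 4 / x ^ 2 * (6 * n / (1 - β)) := by
          gcongr
          exact sum_gibbs_mul_mag_sq_le hβ0 hβ1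
      _ = _ := by field_simp; norm_num
  calc 1 - 40 * n / ((1 - β) * x ^ 2)
      = 1 - 16 * n / ((1 - β) * x ^ 2) - 24 * n / ((1 - β) * x ^ 2) := by ring
    _ ≤ |∑ η ∈ A, law β n t σ η - ∑ η ∈ A, gibbs β n η| :=
        le_trans (by linarith) (le_abs_self _)
    _ ≤ tvDist (law β n t σ) (gibbs β n) := Finset.le_sup'
        (fun A => |∑ η ∈ A, law β n t σ η - ∑ η ∈ A, gibbs β n η|) (Finset.mem_univ A)
    _ ≤ dist β n t :=
        Finset.le_sup' (fun σ => tvDist (law β n t σ) (gibbs β n)) (Finset.mem_univ σ)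

theorem exists_mag_near {n : ℕ} {c : ℝ} (hc0 : 0 ≤ c) (hc1 : c ≤ 1) :
    ∃ σ : Config n, c * n ≤ mag σ ∧ mag σ ≤ c * n + 2 := by
  set k := ⌈(1 + c) * n / 2⌉₊ with hk
  have h1 : (1 + c) * n / 2 ≤ k := Nat.le_ceil _
  have h2 : (k : ℝ) < (1 + c) * n / 2 + 1 := Nat.ceil_lt_add_one (by positivity)
  have h3 : k ≤ n := by
    apply Nat.ceil_le.2
    nlinarith [(Nat.cast_nonneg n : (0 : ℝ) ≤ n)]
  have h4 : mag (fun i : Fin n => if (i : ℕ) < k then (1 : ℤˣ) else -1) = 2 * k - n := by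
    have e (i : Fin n) : spin (fun i : Fin n => if (i : ℕ) < k then (1 : ℤˣ) else -1) i =
        2 * (if (i : ℕ) < k then 1 else 0) - 1 := by
      rw [spin]
      split_ifs <;> norm_num
    rw [mag]
    simp only [e]
    rw [Finset.sum_sub_distrib, ← Finset.mul_sum, Finset.sum_boole, Fin.card_filter_val_lt,
      min_eq_right h3]
    simp
  exact ⟨_, by rw [h4]; linarith, by rw [h4]; linarith⟩

/-! ### Asymptotics -/

theorem dist_nonneg (β : ℝ) (n t : ℕ) : 0 ≤ dist β n t :=
  calc (0 : ℝ) = |∑ η ∈ (∅ : Finset (Config n)), law β n t 1 η -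
          ∑ η ∈ (∅ : Finset (Config n)), gibbs β n η| := by simp
    _ ≤ tvDist (law β n t 1) (gibbs β n) := Finset.le_sup'
        (fun A => |∑ η ∈ A, law β n t 1 η - ∑ η ∈ A, gibbs β n η|) (Finset.mem_univ ∅)
    _ ≤ dist β n t :=
        Finset.le_sup' (fun σ => tvDist (law β n t σ) (gibbs β n)) (Finset.mem_univ 1)

theorem dist_le_one (β : ℝ) (n t : ℕ) [NeZero n] : dist β n t ≤ 1 := by
  refine Finset.sup'_le _ _ fun σ _ => Finset.sup'_le _ _ fun A _ => ?_
  have h1 : ∑ η ∈ A, law β n t σ η ∈ Set.Icc (0 : ℝ) 1 := by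
    rw [sum_law_eq]
    have h0 := step_pow_mono β t (f := fun _ => 0) (g := Set.indicator (A : Set (Config n)) 1)
      (fun η => (indicator_mem_Icc A η).1) σ
    have h1 := step_pow_mono β t (f := Set.indicator (A : Set (Config n)) 1) (g := fun _ => 1)
      (fun η => (indicator_mem_Icc A η).2) σ
    rw [step_pow_const] at h0 h1
    exact ⟨h0, h1⟩
  have h2 : 0 ≤ ∑ η ∈ A, gibbs β n η := Finset.sum_nonneg fun η _ => gibbs_nonneg β η
  have h3 : ∑ η ∈ A, gibbs β n η ≤ 1 := by
    rw [← sum_gibbs β n]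
    exact Finset.sum_le_sum_of_subset_of_nonneg (Finset.subset_univ _)
      fun η _ _ => gibbs_nonneg β η
  rw [abs_le]
  constructor <;> linarith [h1.1, h1.2]

/-- The cut-off time `n log n / (2 (1 - β))`. -/
noncomputable def cutoffTime (β : ℝ) (n : ℕ) : ℝ := (2 * (1 - β))⁻¹ * ((n : ℝ) * Real.log n)

theorem isLittleO_cutoffTime {β : ℝ} (hβ1 : β < 1) :
    (fun n : ℕ => (n : ℝ)) =o[atTop] cutoffTime β := by
  have hb : (2 * (1 - β))⁻¹ ≠ 0 := by
    have : 0 < 1 - β := by linarith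
    positivity
  refine IsLittleO.const_mul_right hb ?_
  have h1 : (fun _ : ℕ => (1 : ℝ)) =o[atTop] fun n : ℕ => Real.log n :=
    (Real.isLittleO_const_log_atTop (c := (1 : ℝ))).comp_tendsto tendsto_natCast_atTop_atTop
  simpa using (isBigO_refl (fun n : ℕ => (n : ℝ)) atTop).mul_isLittleO h1

theorem sqrt_mul_exp_half_log {n : ℕ} (hn : 0 < n) :
    Real.exp (-(Real.log n / 2)) * √n = 1 := by
  have hn' : (0 : ℝ) < n := by exact_mod_cast hn
  rw [← Real.exp_log (Real.sqrt_pos.2 hn'), Real.log_sqrt hn'.le, ← Real.exp_add]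
  simp

theorem dist_add_le {β : ℝ} (hβ0 : 0 ≤ β) (hβ1 : β < 1) {γ : ℝ} (hγ : 1 ≤ γ) {n : ℕ}
    (hn : 0 < n) :
    dist β n ⌊cutoffTime β n + γ * n⌋₊ ≤
      2 * √poincareConst * Real.exp (-((1 - β) * (γ - 1))) := by
  have : NeZero n := ⟨hn.ne'⟩
  have hn' : (0 : ℝ) < n := by exact_mod_cast hn
  have hb : 0 < 1 - β := by linarith
  have hM := poincareConst_pos
  have hT0 : 0 ≤ cutoffTime β n := by
    have := Real.log_natCast_nonneg n
    unfold cutoffTime; positivity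
  set T := ⌊cutoffTime β n + γ * n⌋₊ with hT
  have hT1 : cutoffTime β n + γ * n < T + 1 := Nat.lt_floor_add_one _
  have hT2 : n - 1 ≤ T := by
    have : n ≤ T := Nat.le_floor (by nlinarith)
    lia
  obtain ⟨t, ht⟩ : ∃ t, T = t + (n - 1) := ⟨T - (n - 1), by lia⟩
  have ht' : (T : ℝ) = t + (n - 1) := by
    rw [ht]; push_cast [Nat.one_le_iff_ne_zero.2 hn.ne']; ring
  have hpow : (1 - (1 - β) / n) ^ t ≤
      Real.exp (-((1 - β) * (γ - 1))) * Real.exp (-(Real.log n / 2)) := by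
    calc (1 - (1 - β) / n) ^ t ≤ Real.exp (-((1 - β) / n)) ^ t := by
          gcongr
          · exact rate_nonneg hβ0 n
          · linarith [Real.add_one_le_exp (-((1 - β) / n))]
      _ = Real.exp (t * -((1 - β) / n)) := by rw [← Real.exp_nat_mul]
      _ ≤ Real.exp (-((1 - β) * (γ - 1)) + -(Real.log n / 2)) := by
          apply Real.exp_le_exp.2
          have h1 : cutoffTime β n + (γ - 1) * n ≤ t := by linarith
          have h2 : (1 - β) / n * (cutoffTime β n + (γ - 1) * n) =
              (1 - β) * (γ - 1) + Real.log n / 2 := by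
            unfold cutoffTime
            field_simp
            ring
          have h3 : (1 - β) / n * (cutoffTime β n + (γ - 1) * n) ≤ (1 - β) / n * t := by gcongr
          linarith
      _ = _ := Real.exp_add _ _
  rw [ht]
  calc dist β n (t + (n - 1)) ≤ (1 - (1 - β) / n) ^ t * (2 * √(poincareConst * n)) :=
        dist_le hβ0 hβ1.le t
    _ ≤ Real.exp (-((1 - β) * (γ - 1))) * Real.exp (-(Real.log n / 2)) *
          (2 * √(poincareConst * n)) := by gcongr
    _ = 2 * √poincareConst * Real.exp (-((1 - β) * (γ - 1))) *
          (Real.exp (-(Real.log n / 2)) * √n) := by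
        rw [Real.sqrt_mul hM.le]; ring
    _ = _ := by rw [sqrt_mul_exp_half_log hn, mul_one]

theorem exp_neg_le_one_sub {x : ℝ} (hx1 : x ≤ 1 / 2) :
    Real.exp (-(x + 2 * x ^ 2)) ≤ 1 - x := by
  rw [Real.exp_neg, inv_le_comm₀ (Real.exp_pos _) (by linarith)]
  refine le_trans ?_ (Real.add_one_le_exp (x + 2 * x ^ 2))
  rw [inv_le_iff_one_le_mul₀ (by linarith)]
  nlinarith [mul_nonneg (sq_nonneg x) (sub_nonneg.2 hx1)]

theorem le_dist_sub {β : ℝ} (hβ0 : 0 ≤ β) (hβ1 : β < 1) :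
    ∃ C : ℝ, ∀ γ : ℝ, 0 ≤ γ → ∀ᶠ n : ℕ in atTop,
      1 - C * Real.exp (-(2 * (1 - β) * γ)) ≤ dist β n ⌊cutoffTime β n - γ * n⌋₊ := by
  have hb : 0 < 1 - β := by linarith
  -- the chain starts from magnetization about `c * n`, where the quadratic error in the drift
  -- costs at most half of the linear part
  set c := (1 - β) / 32 with hc
  have hc0 : 0 < c := by positivity
  set c' := c * Real.exp (-1) / 2 with hc'
  have hc'0 : 0 < c' := by positivity
  refine ⟨160 / ((1 - β) * c' ^ 2), fun γ hγ => ?_⟩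
  have ev1 : ∀ᶠ n : ℕ in atTop, γ * n ≤ cutoffTime β n := by
    have := (isLittleO_cutoffTime hβ1).bound (c := (γ + 1)⁻¹) (by positivity)
    filter_upwards [this] with n hn
    have hT0 : 0 ≤ cutoffTime β n := by
      have := Real.log_natCast_nonneg n
      unfold cutoffTime; positivity
    rw [Real.norm_natCast, Real.norm_eq_abs, abs_of_nonneg hT0,
      inv_mul_eq_div, le_div_iff₀ (by positivity)] at hn
    nlinarith [(Nat.cast_nonneg n : (0 : ℝ) ≤ n)]
  have ev2 : ∀ᶠ n : ℕ in atTop, 2 / c ≤ n := tendsto_natCast_atTop_atTop.eventually_ge_atTop _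
  have ev3 : ∀ᶠ n : ℕ in atTop, 15 / (1 - β) ^ 2 / (c' / 2) ≤ √n :=
    (Real.tendsto_sqrt_atTop.comp tendsto_natCast_atTop_atTop).eventually_ge_atTop _
  filter_upwards [ev1, ev2, ev3, eventually_ge_atTop 2] with n h1 h2 h3 hn2
  have : NeZero n := ⟨by lia⟩
  have hn : (2 : ℝ) ≤ n := by exact_mod_cast hn2
  have hn0 : (0 : ℝ) < n := by linarith
  set t := ⌊cutoffTime β n - γ * n⌋₊ with ht
  have ht1 : (t : ℝ) ≤ cutoffTime β n - γ * n := Nat.floor_le (by linarith)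
  obtain ⟨σ, hσ1, hσ2⟩ := exists_mag_near (n := n) hc0.le (by rw [hc]; linarith)
  rw [div_le_iff₀ hc0] at h2
  have hm : c * n / 2 ≤ mag σ - 4 * mag σ ^ 2 / (n * (1 - β)) := by
    have h4 : mag σ ^ 2 ≤ mag σ * (2 * c * n) := by
      rw [sq]
      refine mul_le_mul_of_nonneg_left (by linarith) (le_trans (by positivity) hσ1)
    have h5 : 4 * mag σ ^ 2 / (n * (1 - β)) ≤ mag σ / 2 := by
      rw [div_le_iff₀ (by positivity)]
      have : 4 * (mag σ * (2 * c * n)) ≤ mag σ / 2 * (n * (1 - β)) := by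
        rw [hc]; apply le_of_sub_nonneg
        have h0 : 0 ≤ mag σ := le_trans (by positivity) hσ1
        have : mag σ / 2 * (n * (1 - β)) - 4 * (mag σ * (2 * ((1 - β) / 32) * n)) =
            mag σ * (n * (1 - β)) / 4 := by ring
        rw [this]
        positivity
      linarith
    linarith
  have hpow : Real.exp (-1) * Real.exp (-(Real.log n / 2)) * Real.exp ((1 - β) * γ) ≤
      (1 - (1 - β) / n) ^ t := by
    set x := (1 - β) / n with hx
    have hx0 : 0 ≤ x := by positivity
    have hx1 : x ≤ 1 / 2 := by
      rw [hx, div_le_div_iff₀ hn0 (by norm_num)]; linarith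
    have e1 : cutoffTime β n * x = Real.log n / 2 := by
      rw [hx]; unfold cutoffTime; field_simp
    have e2 : γ * n * x = (1 - β) * γ := by rw [hx]; field_simp
    have e3 : Real.log n * x ≤ 1 := by
      have := Real.log_le_sub_one_of_pos hn0
      rw [hx, mul_div_assoc', div_le_one hn0]
      nlinarith [Real.log_natCast_nonneg n]
    have e4 : t * (x + 2 * x ^ 2) ≤ 1 + Real.log n / 2 - (1 - β) * γ := by
      have h4 : t * x ≤ Real.log n / 2 - (1 - β) * γ := by
        have := mul_le_mul_of_nonneg_right ht1 hx0
        rw [sub_mul, e1, e2] at this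
        exact this
      have h5 : 0 ≤ (1 - β) * γ := by positivity
      have h6 : t * x * x ≤ Real.log n / 2 * x := by gcongr; linarith
      nlinarith
    calc Real.exp (-1) * Real.exp (-(Real.log n / 2)) * Real.exp ((1 - β) * γ)
        = Real.exp (-(1 + Real.log n / 2 - (1 - β) * γ)) := by
          rw [← Real.exp_add, ← Real.exp_add]; congr 1; ring
      _ ≤ Real.exp (t * -(x + 2 * x ^ 2)) := by apply Real.exp_le_exp.2; linarith
      _ = Real.exp (-(x + 2 * x ^ 2)) ^ t := by rw [← Real.exp_nat_mul]
      _ ≤ (1 - x) ^ t := by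
          gcongr
          exact exp_neg_le_one_sub hx1
  have hexp : 1 ≤ Real.exp ((1 - β) * γ) := Real.one_le_exp (by positivity)
  have hs0 : 0 < √(n : ℝ) := Real.sqrt_pos.2 hn0
  have hmean : c' / 2 * (√n * Real.exp ((1 - β) * γ)) ≤ (step β n ^ t) mag σ := by
    refine le_trans ?_ (step_pow_mag_ge hβ0 hβ1 hn2 t σ)
    have h4 : c' * (√n * Real.exp ((1 - β) * γ)) ≤
        (1 - (1 - β) / n) ^ t * (mag σ - 4 * mag σ ^ 2 / (n * (1 - β))) := by
      calc c' * (√n * Real.exp ((1 - β) * γ))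
          = Real.exp (-1) * (Real.exp (-(Real.log n / 2)) * √n) * Real.exp ((1 - β) * γ) *
              (c * √n / 2) := by
            rw [sqrt_mul_exp_half_log (by lia), hc']; ring
        _ = Real.exp (-1) * Real.exp (-(Real.log n / 2)) * Real.exp ((1 - β) * γ) *
              (c * (√n * √n) / 2) := by ring
        _ = Real.exp (-1) * Real.exp (-(Real.log n / 2)) * Real.exp ((1 - β) * γ) *
              (c * n / 2) := by rw [Real.mul_self_sqrt hn0.le]
        _ ≤ _ := by
            gcongr
            exact pow_nonneg (rate_nonneg hβ0 n) t
    rw [div_le_iff₀ (by positivity)] at h3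
    have h5 : √n * (c' / 2) ≤ c' / 2 * (√n * Real.exp ((1 - β) * γ)) := by
      have : √(n : ℝ) ≤ √n * Real.exp ((1 - β) * γ) := by
        nlinarith
      nlinarith
    linarith
  have hpos : 0 < c' / 2 * (√n * Real.exp ((1 - β) * γ)) := by positivity
  refine le_trans ?_ (le_dist hβ0 hβ1 t σ (hpos.trans_le hmean))
  have h6 : 40 * n / ((1 - β) * (step β n ^ t) mag σ ^ 2) ≤
      40 * n / ((1 - β) * (c' / 2 * (√n * Real.exp ((1 - β) * γ))) ^ 2) := by gcongr
  have h7 : 40 * n / ((1 - β) * (c' / 2 * (√n * Real.exp ((1 - β) * γ))) ^ 2) =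
      160 / ((1 - β) * c' ^ 2) * Real.exp (-(2 * (1 - β) * γ)) := by
    have e : Real.exp (-(2 * (1 - β) * γ)) = (Real.exp ((1 - β) * γ) ^ 2)⁻¹ := by
      rw [Real.exp_neg, ← Real.exp_nat_mul]; congr 2; push_cast; ring
    rw [e, mul_pow, mul_pow, Real.sq_sqrt hn0.le]
    field_simp
    norm_num
  linarith

end CurieWeiss

theorem theorem1 (β : ℝ) (hβ0 : 0 ≤ β) (hβ1 : β < 1) :
    CurieWeiss.HasCutoff (CurieWeiss.dist β)
      (fun n : ℕ => (2 * (1 - β))⁻¹ * ((n : ℝ) * Real.log n))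
      (fun n : ℕ => (n : ℝ)) := by
  have hb : 0 < 1 - β := by linarith
  have hbdd (u : ℕ → ℕ) : ∀ᶠ n in atTop, CurieWeiss.dist β n (u n) ≤ 1 := by
    filter_upwards [eventually_gt_atTop 0] with n hn
    have : NeZero n := ⟨hn.ne'⟩
    exact CurieWeiss.dist_le_one β n _
  have hbelow (u : ℕ → ℕ) :
      IsBoundedUnder (· ≥ ·) atTop fun n => CurieWeiss.dist β n (u n) :=
    isBoundedUnder_of ⟨0, fun n => CurieWeiss.dist_nonneg β n _⟩
  have habove (u : ℕ → ℕ) :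
      IsBoundedUnder (· ≤ ·) atTop fun n => CurieWeiss.dist β n (u n) :=
    ⟨1, by simpa using hbdd u⟩
  refine ⟨CurieWeiss.isLittleO_cutoffTime hβ1, ?_, ?_⟩
  · obtain ⟨C, hC⟩ := CurieWeiss.le_dist_sub hβ0 hβ1
    have hlim : Tendsto (fun γ : ℝ => 1 - C * Real.exp (-(2 * (1 - β) * γ))) atTop (𝓝 1) := by
      have h1 : Tendsto (fun γ : ℝ => 2 * (1 - β) * γ) atTop atTop :=
        tendsto_id.const_mul_atTop (by positivity)
      have h2 := (Real.tendsto_exp_neg_atTop_nhds_zero.comp h1).const_mul C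
      simpa using h2.const_sub 1
    refine tendsto_of_tendsto_of_tendsto_of_le_of_le' hlim tendsto_const_nhds ?_ ?_
    · filter_upwards [eventually_ge_atTop 0] with γ hγ
      exact le_liminf_of_le (habove _).isCoboundedUnder_ge (hC γ hγ)
    · refine Eventually.of_forall fun γ => ?_
      exact (liminf_le_limsup (habove _) (hbelow _)).trans
        (limsup_le_of_le (hbelow _).isCoboundedUnder_le (hbdd _))
  · have hlim : Tendsto (fun γ : ℝ => 2 * √CurieWeiss.poincareConst *
        Real.exp (-((1 - β) * (γ - 1)))) atTop (𝓝 0) := by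
      have h1 : Tendsto (fun γ : ℝ => (1 - β) * (γ - 1)) atTop atTop :=
        (tendsto_atTop_add_const_right _ (-1) tendsto_id).const_mul_atTop hb
      have h2 := (Real.tendsto_exp_neg_atTop_nhds_zero.comp h1).const_mul
        (2 * √CurieWeiss.poincareConst)
      simpa using h2
    refine tendsto_of_tendsto_of_tendsto_of_le_of_le' tendsto_const_nhds hlim ?_ ?_
    · refine Eventually.of_forall fun γ => ?_
      exact (le_liminf_of_le (habove _).isCoboundedUnder_ge
        (Eventually.of_forall fun n => CurieWeiss.dist_nonneg β n _)).trans
          (liminf_le_limsup (habove _) (hbelow _))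
    · filter_upwards [eventually_ge_atTop 1] with γ hγ
      refine limsup_le_of_le (hbelow _).isCoboundedUnder_le ?_
      filter_upwards [eventually_gt_atTop 0] with n hn
      exact CurieWeiss.dist_add_le hβ0 hβ1 hγ hn
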